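/- All scalars are real, $\mathbb N=\{1,2,\dots\}$, and $L_1=L_1[0,1]$ with Lebesgue measure. Let $\ell_\infty^m(\ell_1^m)$ be the space of real $m\times m$ arrays $(a_{i,j})$ with norm $\max_i\sum_j|a_{i,j}|$, and let $e_{i,j}$ be its unit vector basis. For each $m\in\mathbb N$ let $T^{(m)}\colon\ell_\infty^m(\ell_1^m)\to L_1$ be a linear operator such that the entries $T^{(m)}_{i,j}=T^{(m)}(e_{i,j})$ $(1\le i,j\le m)$ of the corresponding random matrix are independent, symmetric random variables on $[0,1]$, and such that $\|T^{(m)}\|\le 1$. Then $$\|T^{(m)}\|=\max\Big\{\mathbb E\Big|\sum_{i=1}^m T^{(m)}_{i,j_i}\Big| : j_1,\dots,j_m\in\{1,\dots,m\}\Big\}\qquad(m\in\mathbb N),$$ and exactly one of the following two alternatives holds: (i) the identity operators $\mathrm{id}_{\ell_1^k}$ $(k\in\mathbb N)$ uniformly factor through the $T^{(m)}$, i.e. there is $C>0$ such that for every $k\in\mathbb N$ there are $m\in\mathbb N$ and operators $A\colon\ell_1^k\to\ell_\infty^m(\ell_1^m)$ and $B\colon L_1\to\ell_1^k$ with $\mathrm{id}_{\ell_1^k}=B\,T^{(m)}A$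 and $\|A\|\cdot\|B\|\le C$; (ii) the $T^{(m)}$ uniformly approximately factor through $\ell_\infty^k$ $(k\in\mathbb N)$, i.e. for every $\varepsilon>0$ there is $C>0$ such that for every $m\in\mathbb N$ there are $k\in\mathbb N$ and operators $A\colon\ell_\infty^m(\ell_1^m)\to\ell_\infty^k$ and $B\colon\ell_\infty^k\to L_1$ with $\|T^{(m)}-BA\|<\varepsilon$ and $\|A\|\cdot\|B\|\le C$. -/

import Mathlib

open MeasureTheory ProbabilityTheory

/-- The real space `ℓ₁^k`. -/
abbrev EllOne (k : ℕ) : Type := PiLp 1 (fun _ : Fin k => ℝ)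

/-- The real space `ℓ_∞^k`: the norm on `Fin k → ℝ` is the maximum norm. -/
abbrev EllInfty (k : ℕ) : Type := Fin k → ℝ

/-- The real space `ℓ_∞^m(ℓ₁^m)`: the `ℓ_∞`-sum of `m` copies of `ℓ₁^m`, so that the norm of
`(a i j)` is `max_i ∑_j |a i j|`. -/
abbrev EllInftyEllOne (m : ℕ) : Type := Fin m → EllOne m

/-- The real space `L₁ = L₁[0,1]` with Lebesgue measure. -/
abbrev LOne : Type := Lp ℝ 1 (volume : Measure unitInterval)

/-- The unit vector `e_{i,j}` of `ℓ_∞^m(ℓ₁^m)`. -/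
noncomputable def unitVec {m : ℕ} (i j : Fin m) : EllInftyEllOne m :=
  Pi.single i (WithLp.toLp 1 (Pi.single j 1))

/-- The entry `T_{i,j} = T e_{i,j}` of the random matrix of `T : ℓ_∞^m(ℓ₁^m) → L₁`,
as a random variable on `[0,1]`. -/
noncomputable def matrixEntry {m : ℕ} (T : EllInftyEllOne m →L[ℝ] LOne) (i j : Fin m) :
    unitInterval → ℝ :=
  T (unitVec i j)

/-- A real random variable `X` is symmetric if `X` and `-X` have the same distribution. -/
def IsSymmetricRV {Ω : Type*} [MeasurableSpace Ω] (X : Ω → ℝ) (μ : Measure Ω) : Prop :=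
  IdentDistrib X (fun ω => -X ω) μ μ

section Factorization

variable {I J : Type*} {E F : I → Type*} {G H : J → Type*}
  [∀ i, NormedAddCommGroup (E i)] [∀ i, NormedSpace ℝ (E i)]
  [∀ i, NormedAddCommGroup (F i)] [∀ i, NormedSpace ℝ (F i)]
  [∀ j, NormedAddCommGroup (G j)] [∀ j, NormedSpace ℝ (G j)]
  [∀ j, NormedAddCommGroup (H j)] [∀ j, NormedSpace ℝ (H j)]

/-- The operators `U i` uniformly factor through the operators `V j`. -/
def UniformlyFactorThrough (U : ∀ i, E i →L[ℝ] F i) (V : ∀ j, G j →L[ℝ] H j) : Prop :=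
  ∃ C : ℝ, 0 < C ∧ ∀ i, ∃ j, ∃ A : E i →L[ℝ] G j, ∃ B : H j →L[ℝ] F i,
    U i = B ∘L V j ∘L A ∧ ‖A‖ * ‖B‖ ≤ C

/-- The operators `U i` uniformly approximately factor through the operators `V j`. -/
def UniformlyApproxFactorThrough (U : ∀ i, E i →L[ℝ] F i) (V : ∀ j, G j →L[ℝ] H j) : Prop :=
  ∀ ε : ℝ, 0 < ε → ∃ C : ℝ, 0 < C ∧ ∀ i, ∃ j, ∃ A : E i →L[ℝ] G j, ∃ B : H j →L[ℝ] F i,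
    ‖U i - B ∘L V j ∘L A‖ < ε ∧ ‖A‖ * ‖B‖ ≤ C

end Factorization

/-! Call a choice of one entry from each row a path. The norm is convex in each row of the array, so
the unit ball may be replaced by signed paths. Since the entries are independent and symmetric,
signs do not change the law of a path sum, and the norm formula follows. With Khinchine's inequality
it bounds the expected square function of every path by `√3`.

The dichotomy concerns the large parts of the entries. Ask whether for some `ε > 0` and every `k`
some matrix has `k` disjoint paths, each with total expected excess at least `ε` over the level `4 *
k`.

If so, Markov's inequality shows that with probability at least `1 / 2` no entry on these paths
exceeds the level. Let the spike of an entry be its sign on the event that it alone is large. Spikes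
have disjoint supports, are orthogonal to all other entries by symmetry, and pair with their own
entry to at least half its expected excess. Sending `e_s` to the `s`-th path and integrating against
normalised sums of spikes recovers the identity of `ℓ₁^k` with constant `2 / ε`
(`exists_factorization_id`).

If not, fix `ε` and a `k` where this fails. Sorting the rows by expected excess, one removes fewer
than `k` entries from each row so that the remaining tails form an operator of norm less than `ε`
(`exists_small_off_rows`). The removed entries factor through `ℓ_∞` because a row supported on few
coordinates has comparable `ℓ₁` and `ℓ_∞` norms. The remaining truncated entries have variances with
bounded sum along every path (`sum_integral_trunc_sq_le`). Hence orthogonality in `L₂` and Bessel's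
inequality let their operator factor through the embedding of `ℓ₁^m` into `ℓ_∞` of the sign cube
(`factorsThroughSup_trunc`).

Both alternatives together would approximately factor the identities of `ℓ₁^k` through `ℓ_∞^n` with
a fixed constant, which a trace estimate forbids (`card_le_of_approx_id`). -/

/-- The difference of the two sides has a double zero at `|s| = t`. The bound turns second and
fourth moments into a lower bound for a first moment, with `t` free to be optimised. -/
lemma abs_ge_quartic (s : ℝ) {t : ℝ} (ht : 0 < t) :
    3 / 2 * s ^ 2 / t - s ^ 4 / (2 * t ^ 3) ≤ |s| := by
  have h : |s| - (3 / 2 * |s| ^ 2 / t - |s| ^ 4 / (2 * t ^ 3))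
      = |s| * (|s| - t) ^ 2 * (|s| + 2 * t) / (2 * t ^ 3) := by
    field_simp; ring
  have h2 : 0 ≤ |s| * (|s| - t) ^ 2 * (|s| + 2 * t) / (2 * t ^ 3) := by positivity
  have h4 : |s| ^ 4 = s ^ 4 := by rw [show (4 : ℕ) = 2 * 2 from rfl, pow_mul, pow_mul, sq_abs]
  rw [← h, sq_abs, h4] at h2
  linarith

/-! ### Rademacher averages over the finite sign cube. -/

section Signs

variable {ι : Type*} [DecidableEq ι]

/-- Change the sign of the coordinate `p`. -/
def flipAt {M : Type*} [Neg M] (p : ι) (x : ι → M) : ι → M := Function.update x p (-x p)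

lemma flipAt_involutive {M : Type*} [InvolutiveNeg M] (p : ι) :
    Function.Involutive (flipAt (M := M) p) := by
  intro x; ext i
  by_cases h : i = p <;> simp [flipAt, h]

lemma sum_eq_zero_of_flipAt [Fintype ι] (p : ι) (F : (ι → ℤˣ) → ℝ) (hF : ∀ θ, F (flipAt p θ) = -F θ) :
    ∑ θ, F θ = 0 := by
  have h := Equiv.sum_comp (flipAt_involutive (M := ℤˣ) p).toPerm F
  simp only [Function.Involutive.coe_toPerm, hF, Finset.sum_neg_distrib] at h
  linarith

/-- The value of a sign as a real number. -/
def unitSign (u : ℤˣ) : ℝ := ((u : ℤ) : ℝ)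

lemma unitSign_sq (u : ℤˣ) : unitSign u ^ 2 = 1 := by
  rcases Int.units_eq_one_or u with rfl | rfl <;> simp [unitSign]

lemma abs_unitSign (u : ℤˣ) : |unitSign u| = 1 := by
  rcases Int.units_eq_one_or u with rfl | rfl <;> simp [unitSign]

lemma unitSign_neg (u : ℤˣ) : unitSign (-u) = -unitSign u := by simp [unitSign]

lemma unitSign_flipAt_self (p : ι) (θ : ι → ℤˣ) : unitSign (flipAt p θ p) = -unitSign (θ p) := by
  simp [flipAt, unitSign_neg]

lemma flipAt_of_ne {M : Type*} [Neg M] {p i : ι} (h : i ≠ p) (x : ι → M) :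
    flipAt p x i = x i := by
  simp [flipAt, h]

lemma sum_flipAt {p : ι} {s : Finset ι} (hp : p ∉ s) (a : ι → ℝ) (θ : ι → ℤˣ) :
    ∑ i ∈ s, a i * unitSign (flipAt p θ i) = ∑ i ∈ s, a i * unitSign (θ i) := by
  refine Finset.sum_congr rfl fun i hi => ?_
  rw [flipAt_of_ne (ne_of_mem_of_not_mem hi hp)]

variable [Fintype ι]

/-- Orthogonality of the Rademacher functions. -/
lemma sum_unitSign_mul (i j : ι) :
    ∑ θ : ι → ℤˣ, unitSign (θ i) * unitSign (θ j)
      = if i = j then (Fintype.card (ι → ℤˣ) : ℝ) else 0 := by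
  split_ifs with h
  · subst h
    simp [← sq, unitSign_sq]
  · refine sum_eq_zero_of_flipAt i _ fun θ => ?_
    rw [unitSign_flipAt_self, flipAt_of_ne (Ne.symm h)]; ring

lemma sum_sq_rademacher (a : ι → ℝ) (s : Finset ι) :
    ∑ θ : ι → ℤˣ, (∑ i ∈ s, a i * unitSign (θ i)) ^ 2
      = Fintype.card (ι → ℤˣ) * ∑ i ∈ s, a i ^ 2 := by
  induction s using Finset.induction_on with
  | empty => simp
  | insert p s hp ih =>
    have h0 : ∑ θ : ι → ℤˣ, 2 * (a p * unitSign (θ p)) * ∑ i ∈ s, a i * unitSign (θ i) = 0 :=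
      sum_eq_zero_of_flipAt p _ fun θ => by
        rw [sum_flipAt hp, unitSign_flipAt_self]; ring
    have h1 : ∀ θ : ι → ℤˣ, (∑ i ∈ insert p s, a i * unitSign (θ i)) ^ 2
        = a p ^ 2 + 2 * (a p * unitSign (θ p)) * (∑ i ∈ s, a i * unitSign (θ i))
          + (∑ i ∈ s, a i * unitSign (θ i)) ^ 2 := fun θ => by
      rw [Finset.sum_insert hp]
      linear_combination a p ^ 2 * unitSign_sq (θ p)
    have hc : ∑ _θ : ι → ℤˣ, a p ^ 2 = (Fintype.card (ι → ℤˣ) : ℝ) * a p ^ 2 := by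
      rw [Finset.sum_const, nsmul_eq_mul, Finset.card_univ]
    simp only [h1]
    rw [Finset.sum_add_distrib, Finset.sum_add_distrib, h0, ih, hc, Finset.sum_insert hp]
    ring

/-- Adding one coordinate, the odd powers of its sign average to zero; what remains is dominated by
the expansion of three times the squared variance. -/
lemma sum_pow_four_rademacher_le (a : ι → ℝ) (s : Finset ι) :
    ∑ θ : ι → ℤˣ, (∑ i ∈ s, a i * unitSign (θ i)) ^ 4
      ≤ Fintype.card (ι → ℤˣ) * (3 * (∑ i ∈ s, a i ^ 2) ^ 2) := by
  induction s using Finset.induction_on with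
  | empty => simp
  | insert p s hp ih =>
    set N : ℝ := (Fintype.card (ι → ℤˣ) : ℝ) with hN
    have h0 : ∑ θ : ι → ℤˣ, (4 * (a p * unitSign (θ p)) * (∑ i ∈ s, a i * unitSign (θ i)) ^ 3
        + 4 * (a p ^ 3 * unitSign (θ p)) * (∑ i ∈ s, a i * unitSign (θ i))) = 0 :=
      sum_eq_zero_of_flipAt p _ fun θ => by
        rw [sum_flipAt hp, unitSign_flipAt_self]; ring
    have h1 : ∀ θ : ι → ℤˣ, (∑ i ∈ insert p s, a i * unitSign (θ i)) ^ 4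
        = a p ^ 4 + (4 * (a p * unitSign (θ p)) * (∑ i ∈ s, a i * unitSign (θ i)) ^ 3
          + 4 * (a p ^ 3 * unitSign (θ p)) * (∑ i ∈ s, a i * unitSign (θ i)))
          + 6 * a p ^ 2 * (∑ i ∈ s, a i * unitSign (θ i)) ^ 2
          + (∑ i ∈ s, a i * unitSign (θ i)) ^ 4 := fun θ => by
      rw [Finset.sum_insert hp]
      linear_combination (a p ^ 4 * (unitSign (θ p) ^ 2 + 1)
        + 4 * a p ^ 3 * unitSign (θ p) * (∑ i ∈ s, a i * unitSign (θ i))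
        + 6 * a p ^ 2 * (∑ i ∈ s, a i * unitSign (θ i)) ^ 2) * unitSign_sq (θ p)
    have hc : ∑ _θ : ι → ℤˣ, a p ^ 4 = N * a p ^ 4 := by
      rw [Finset.sum_const, nsmul_eq_mul, Finset.card_univ]
    simp only [h1]
    rw [Finset.sum_add_distrib, Finset.sum_add_distrib, Finset.sum_add_distrib, h0, hc,
      ← Finset.mul_sum, sum_sq_rademacher, Finset.sum_insert hp, ← hN]
    have : 0 ≤ N * a p ^ 4 := by positivity
    linarith

/-- Khinchine's inequality. -/
lemma khinchine (a : ι → ℝ) :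
    Fintype.card (ι → ℤˣ) * √(∑ i, a i ^ 2)
      ≤ √3 * ∑ θ : ι → ℤˣ, |∑ i, a i * unitSign (θ i)| := by
  set N : ℝ := (Fintype.card (ι → ℤˣ) : ℝ) with hN
  have hV0 : 0 ≤ ∑ i, a i ^ 2 := Finset.sum_nonneg fun i _ => sq_nonneg _
  rcases hV0.eq_or_lt with h0 | hpos
  · rw [← h0]; simp; positivity
  set r : ℝ := √(∑ i, a i ^ 2) with hr
  have hr0 : 0 < r := Real.sqrt_pos.2 hpos
  have hrs : ∑ i, a i ^ 2 = r ^ 2 := (Real.sq_sqrt hV0).symm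
  set w : ℝ := √3 with hw
  have hw0 : 0 < w := by positivity
  have hws : w ^ 2 = 3 := Real.sq_sqrt (by norm_num)
  -- The choice `t = √3 * r` maximises the lower bound obtained from the moments `r ^ 2` and `3 * r
  -- ^ 4`.
  have h1 := Finset.sum_le_sum fun (θ : ι → ℤˣ) (_ : θ ∈ Finset.univ) =>
    abs_ge_quartic (∑ i, a i * unitSign (θ i)) (t := w * r) (by positivity)
  rw [Finset.sum_sub_distrib, ← Finset.sum_div, ← Finset.sum_div, ← Finset.mul_sum,
    sum_sq_rademacher, ← hN, hrs] at h1
  have h2 := sum_pow_four_rademacher_le a Finset.univ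
  rw [← hN, hrs] at h2
  have h3 : (∑ θ : ι → ℤˣ, (∑ i, a i * unitSign (θ i)) ^ 4) / (2 * (w * r) ^ 3)
      ≤ N * (3 * (r ^ 2) ^ 2) / (2 * (w * r) ^ 3) := by gcongr
  have h4 : 3 / 2 * (N * r ^ 2) / (w * r) - N * (3 * (r ^ 2) ^ 2) / (2 * (w * r) ^ 3)
      = N * r / w := by
    have : (w * r) ^ 3 = 3 * w * r ^ 3 := by rw [mul_pow, pow_succ, hws]
    rw [this]; field_simp; ring
  have h5 : N * r / w ≤ ∑ θ : ι → ℤˣ, |∑ i, a i * unitSign (θ i)| := by linarith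
  rw [div_le_iff₀ hw0] at h5
  linarith

/-- Bessel's inequality for the Rademacher functions. -/
lemma bessel_rademacher (g : (ι → ℤˣ) → ℝ) {M : ℝ} (hg : ∀ θ, |g θ| ≤ M) :
    ∑ i, ((∑ θ, g θ * unitSign (θ i)) / Fintype.card (ι → ℤˣ)) ^ 2 ≤ M ^ 2 := by
  set N : ℝ := (Fintype.card (ι → ℤˣ) : ℝ) with hN
  have hN0 : 0 < N := by rw [hN]; exact_mod_cast Fintype.card_pos
  set c : ι → ℝ := fun i => (∑ θ, g θ * unitSign (θ i)) / N with hc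
  have h0 : 0 ≤ ∑ θ, (g θ - ∑ i, c i * unitSign (θ i)) ^ 2 :=
    Finset.sum_nonneg fun _ _ => sq_nonneg _
  have h1 : ∑ θ, g θ * ∑ i, c i * unitSign (θ i) = N * ∑ i, c i ^ 2 := by
    simp only [Finset.mul_sum]
    rw [Finset.sum_comm]
    refine Finset.sum_congr rfl fun i _ => ?_
    have : ∑ θ, g θ * unitSign (θ i) = N * c i := by simp only [hc]; field_simp
    rw [sq, ← mul_assoc, ← this, Finset.sum_mul]
    exact Finset.sum_congr rfl fun _ _ => by ring
  have h2 : ∑ θ, (g θ - ∑ i, c i * unitSign (θ i)) ^ 2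
      = ∑ θ, g θ ^ 2 - N * ∑ i, c i ^ 2 := by
    have : ∀ θ, (g θ - ∑ i, c i * unitSign (θ i)) ^ 2
        = g θ ^ 2 - 2 * (g θ * ∑ i, c i * unitSign (θ i)) + (∑ i, c i * unitSign (θ i)) ^ 2 :=
      fun θ => by ring
    simp only [this]
    rw [Finset.sum_add_distrib, Finset.sum_sub_distrib, ← Finset.mul_sum, h1, sum_sq_rademacher]
    ring
  have h3 : ∑ θ, g θ ^ 2 ≤ N * M ^ 2 := by
    calc ∑ θ, g θ ^ 2 ≤ ∑ _θ : ι → ℤˣ, M ^ 2 :=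
          Finset.sum_le_sum fun θ _ => sq_le_sq.2 ((hg θ).trans (le_abs_self M))
      _ = N * M ^ 2 := by rw [Finset.sum_const, nsmul_eq_mul, Finset.card_univ]
  have : N * ∑ i, c i ^ 2 ≤ N * M ^ 2 := by linarith
  exact le_of_mul_le_mul_left this hN0

end Signs

/-! ### Truncation and excess at a level. -/

section Truncation

/-- Truncation of a real number at level `K`. -/
noncomputable def trunc (K x : ℝ) : ℝ := if |x| ≤ K then x else 0

/-- The absolute value of `x` if it exceeds `K`, and `0` otherwise. -/
noncomputable def excess (K x : ℝ) : ℝ := if |x| ≤ K then 0 else |x|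

lemma measurable_trunc (K : ℝ) : Measurable (trunc K) :=
  Measurable.ite (measurableSet_le (by fun_prop) (by fun_prop)) measurable_id measurable_const

lemma measurable_excess (K : ℝ) : Measurable (excess K) :=
  Measurable.ite (measurableSet_le (by fun_prop) (by fun_prop)) measurable_const (by fun_prop)

lemma abs_trunc_le_abs (K x : ℝ) : |trunc K x| ≤ |x| := by
  unfold trunc; split_ifs <;> simp

lemma abs_trunc_le {K : ℝ} (hK : 0 ≤ K) (x : ℝ) : |trunc K x| ≤ K := by
  unfold trunc; split_ifs with h
  · exact h
  · simpa using hK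

lemma trunc_neg (K x : ℝ) : trunc K (-x) = -trunc K x := by
  unfold trunc; rw [abs_neg]; split_ifs <;> simp

lemma excess_nonneg (K x : ℝ) : 0 ≤ excess K x := by
  unfold excess; split_ifs <;> simp

lemma abs_sub_trunc (K x : ℝ) : |x - trunc K x| = excess K x := by
  unfold excess trunc; split_ifs <;> simp

lemma sqrt_sum_sq_le_sum_abs {ι : Type*} (s : Finset ι) (x : ι → ℝ) :
    √(∑ i ∈ s, x i ^ 2) ≤ ∑ i ∈ s, |x i| := by
  apply Real.sqrt_le_iff.2 ⟨Finset.sum_nonneg fun _ _ => abs_nonneg _, ?_⟩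
  simpa using Finset.sum_sq_le_sq_sum_of_nonneg (s := s) (f := fun i => |x i|) (fun _ _ => abs_nonneg _)

end Truncation

/-! ### Moments of independent symmetric random variables. -/

section SymmetricVectors

variable {Ω ι : Type*} [MeasurableSpace Ω] {μ : Measure Ω} {X : ι → Ω → ℝ}

lemma integrable_sqrt_sum_sq (hX : ∀ i, Measurable (X i)) (hint : ∀ i, Integrable (X i) μ)
    (s : Finset ι) : Integrable (fun ω => √(∑ i ∈ s, X i ω ^ 2)) μ := by
  refine (integrable_finsetSum s fun i _ => (hint i).abs).mono' ?_ (ae_of_all _ fun ω => ?_)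
  · exact (Finset.measurable_sum s fun i _ => (hX i).pow_const 2).sqrt.aestronglyMeasurable
  · rw [Real.norm_of_nonneg (Real.sqrt_nonneg _)]
    exact sqrt_sum_sq_le_sum_abs s _

variable [IsProbabilityMeasure μ]

lemma memLp_trunc (hX : ∀ i, Measurable (X i)) {K : ℝ} (hK : 0 ≤ K) (i : ι) (p : ENNReal) :
    MemLp (fun ω => trunc K (X i ω)) p μ :=
  MemLp.of_bound ((measurable_trunc K).comp (hX i)).aestronglyMeasurable K
    (ae_of_all _ fun _ => abs_trunc_le hK _)

lemma sq_integral_abs_le {f : Ω → ℝ} (hf : MemLp f 2 μ) :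
    (∫ ω, |f ω| ∂μ) ^ 2 ≤ ∫ ω, f ω ^ 2 ∂μ := by
  have h := variance_nonneg |f| μ
  rw [variance_eq_sub hf.abs] at h
  simp only [Pi.pow_apply, Pi.abs_apply, sq_abs] at h
  linarith

/-- Markov's inequality for the square function, which dominates each `|X i|`. -/
lemma measureReal_exists_gt_le (hX : ∀ i, Measurable (X i)) (hint : ∀ i, Integrable (X i) μ)
    (s : Finset ι) {K M : ℝ} (hK : 0 < K) (hM : ∫ ω, √(∑ i ∈ s, X i ω ^ 2) ∂μ ≤ M) :
    μ.real {ω | ∃ i ∈ s, K < |X i ω|} ≤ M / K := by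
  have h := mul_meas_ge_le_integral_of_nonneg (ae_of_all μ fun ω => Real.sqrt_nonneg _)
    (integrable_sqrt_sum_sq hX hint s) K
  rw [le_div_iff₀ hK, mul_comm]
  refine le_trans ?_ (h.trans hM)
  gcongr
  · exact measure_ne_top _ _
  · rintro ⟨i, hi, hiK⟩
    refine hiK.le.trans ?_
    rw [← Real.sqrt_sq_eq_abs]
    exact Real.sqrt_le_sqrt
      (Finset.single_le_sum (f := fun i => X i _ ^ 2) (fun i _ => sq_nonneg _) hi)

variable [Fintype ι]

/-- By independence both joint laws are product measures, and by symmetry their marginals agree. -/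
lemma map_unitSign_mul (hX : ∀ i, Measurable (X i)) (hI : iIndepFun X μ)
    (hS : ∀ i, IsSymmetricRV (X i) μ) (s : ι → ℤˣ) :
    μ.map (fun ω i => unitSign (s i) * X i ω) = μ.map (fun ω i => X i ω) := by
  have h1 := (iIndepFun_iff_map_fun_eq_pi_map fun i => (hX i).aemeasurable).1 hI
  have hm : ∀ i, Measurable ((fun x => unitSign (s i) * x) ∘ X i) := fun i =>
    (measurable_const_mul _).comp (hX i)
  have h2 := (iIndepFun_iff_map_fun_eq_pi_map fun i => (hm i).aemeasurable).1
    (hI.comp (fun i x => unitSign (s i) * x) fun i => measurable_const_mul _)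
  rw [h1]
  refine h2.trans ?_
  congr 1
  ext1 i
  rcases Int.units_eq_one_or (s i) with h | h
  · congr 1; ext ω; simp [h, unitSign]
  · rw [(hS i).map_eq]
    congr 1; ext ω; simp [h, unitSign]

lemma integral_unitSign_mul (hX : ∀ i, Measurable (X i)) (hI : iIndepFun X μ)
    (hS : ∀ i, IsSymmetricRV (X i) μ) (s : ι → ℤˣ) {G : (ι → ℝ) → ℝ} (hG : Measurable G) :
    ∫ ω, G (fun i => unitSign (s i) * X i ω) ∂μ = ∫ ω, G (fun i => X i ω) ∂μ := by
  have h1 : Measurable fun ω i => unitSign (s i) * X i ω :=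
    measurable_pi_lambda _ fun i => (hX i).const_mul _
  have h2 : Measurable fun ω i => X i ω := measurable_pi_lambda _ hX
  rw [← integral_map (φ := fun ω i => unitSign (s i) * X i ω) (f := G) h1.aemeasurable
      hG.aestronglyMeasurable,
    ← integral_map (φ := fun ω i => X i ω) (f := G) h2.aemeasurable hG.aestronglyMeasurable,
    map_unitSign_mul hX hI hS]

/-- Uniform integrability of the square function bounds the variances of the truncations. -/
lemma sum_integral_trunc_sq_le (hX : ∀ i, Measurable (X i)) (hint : ∀ i, Integrable (X i) μ)
    (hI : iIndepFun X μ) {K M : ℝ} (hK : 0 ≤ K) (hM : ∫ ω, √(∑ i, X i ω ^ 2) ∂μ ≤ M) :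
    ∑ i, ∫ ω, trunc K (X i ω) ^ 2 ∂μ ≤ K ^ 2 + 2 * M ^ 2 := by
  set v : ℝ := ∑ i, ∫ ω, trunc K (X i ω) ^ 2 ∂μ with hv
  -- If `v` exceeds `K ^ 2`, then the variance bound `K ^ 2 * v` is at most `v ^ 2`, so the sum of
  -- squares has second moment at most `2 * v ^ 2` and cannot concentrate its mean on a small event.
  rcases le_or_gt v (K ^ 2) with h | hvK
  · nlinarith [sq_nonneg M]
  have hv0 : 0 < v := (sq_nonneg K).trans_lt hvK
  let Y : ι → Ω → ℝ := fun i ω => trunc K (X i ω) ^ 2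
  have hYm : ∀ i, Measurable (Y i) := fun i => ((measurable_trunc K).comp (hX i)).pow_const 2
  have hY0 : ∀ i ω, 0 ≤ Y i ω := fun i ω => sq_nonneg _
  have hYK : ∀ i ω, Y i ω ≤ K ^ 2 := fun i ω =>
    sq_le_sq.2 ((abs_trunc_le hK _).trans (le_abs_self K))
  have hYL : ∀ i, MemLp (Y i) 2 μ := fun i =>
    MemLp.of_bound (hYm i).aestronglyMeasurable (K ^ 2)
      (ae_of_all _ fun ω => by rw [Real.norm_of_nonneg (hY0 i ω)]; exact hYK i ω)
  have hYint : ∀ i, Integrable (Y i) μ := fun i => (hYL i).integrable (by norm_num)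
  have hYI : iIndepFun Y μ :=
    hI.comp (fun _ x => trunc K x ^ 2) fun _ => (measurable_trunc K).pow_const 2
  have hZL : MemLp (∑ i, Y i) 2 μ := memLp_finsetSum' _ fun i _ => hYL i
  have hZv : ∫ ω, (∑ i, Y i) ω ∂μ = v := by
    simp only [Finset.sum_apply]
    rw [integral_finsetSum _ fun i _ => hYint i]
  have hvar : Var[∑ i, Y i; μ] ≤ v ^ 2 := by
    rw [IndepFun.variance_sum (fun i _ => hYL i) fun i _ j _ hij => hYI.indepFun hij]
    calc ∑ i, Var[Y i; μ] ≤ ∑ i, K ^ 2 * ∫ ω, Y i ω ∂μ := by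
          refine Finset.sum_le_sum fun i _ => ?_
          rw [← integral_const_mul]
          refine (variance_le_expectation_sq (hYm i).aestronglyMeasurable).trans ?_
          refine integral_mono (hYL i).integrable_sq ((hYint i).const_mul _) fun ω => ?_
          simp only [Pi.pow_apply, sq (Y i ω)]
          exact mul_le_mul_of_nonneg_right (hYK i ω) (hY0 i ω)
      _ = K ^ 2 * v := by rw [← Finset.mul_sum]
      _ ≤ v ^ 2 := by nlinarith
  have hZ2 : ∫ ω, ((∑ i, Y i) ω) ^ 2 ∂μ ≤ 2 * v ^ 2 := by
    have := variance_eq_sub hZL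
    rw [hZv] at this
    simp only [Pi.pow_apply] at this
    linarith
  -- This `t` is optimal for first moment `v` and second moment `2 * v ^ 2`; the resulting lower
  -- bound is `t / 2`.
  set t : ℝ := √(2 * v) with ht
  have ht0 : 0 < t := Real.sqrt_pos.2 (by linarith)
  have hts : t ^ 2 = 2 * v := Real.sq_sqrt (by linarith)
  have hlow : ∫ ω, (3 / 2 * (∑ i, Y i) ω / t - ((∑ i, Y i) ω) ^ 2 / (2 * t ^ 3)) ∂μ
      ≤ ∫ ω, √(∑ i, X i ω ^ 2) ∂μ := by
    refine integral_mono ?_ (integrable_sqrt_sum_sq hX hint _) fun ω => ?_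
    · exact (((hZL.integrable (by norm_num)).const_mul _).div_const _).sub
        (hZL.integrable_sq.div_const _)
    · have hZ0 : 0 ≤ (∑ i, Y i) ω := by
        rw [Finset.sum_apply]; exact Finset.sum_nonneg fun i _ => hY0 i ω
      have h1 := abs_ge_quartic (√((∑ i, Y i) ω)) ht0
      have h4 : √((∑ i, Y i) ω) ^ 4 = ((∑ i, Y i) ω) ^ 2 := by
        rw [show (4 : ℕ) = 2 * 2 from rfl, pow_mul, Real.sq_sqrt hZ0]
      rw [Real.sq_sqrt hZ0, h4, abs_of_nonneg (Real.sqrt_nonneg _)] at h1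
      refine h1.trans (Real.sqrt_le_sqrt ?_)
      rw [Finset.sum_apply]
      exact Finset.sum_le_sum fun i _ => sq_le_sq.2 (abs_trunc_le_abs _ _)
  rw [integral_sub (((hZL.integrable (by norm_num)).const_mul _).div_const _)
    (hZL.integrable_sq.div_const _), integral_div, integral_div, integral_const_mul, hZv] at hlow
  have h5 : (∫ ω, ((∑ i, Y i) ω) ^ 2 ∂μ) / (2 * t ^ 3) ≤ 2 * v ^ 2 / (2 * t ^ 3) := by gcongr
  have h6 : 3 / 2 * v / t - 2 * v ^ 2 / (2 * t ^ 3) = t / 2 := by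
    have : v = t ^ 2 / 2 := by linarith
    rw [this]; field_simp; ring
  have h7 : t / 2 ≤ M := by linarith
  nlinarith [sq_nonneg K]

variable [DecidableEq ι]

lemma integral_eq_zero_of_flipAt (hX : ∀ i, Measurable (X i)) (hI : iIndepFun X μ)
    (hS : ∀ i, IsSymmetricRV (X i) μ) (p : ι) {G : (ι → ℝ) → ℝ} (hG : Measurable G)
    (h : ∀ x, G (flipAt p x) = -G x) : ∫ ω, G (fun i => X i ω) ∂μ = 0 := by
  have h1 := integral_unitSign_mul hX hI hS (flipAt p 1) hG
  have h2 : ∀ ω, (fun i => unitSign ((flipAt p 1 : ι → ℤˣ) i) * X i ω)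
      = flipAt p (fun i => X i ω) := fun ω => by
    ext i
    by_cases hi : i = p <;> simp [flipAt, hi, unitSign]
  simp only [h2, h, integral_neg] at h1
  linarith

/-- Khinchine's inequality holds pointwise in `ω`; after integration every choice of signs
contributes the same amount, by symmetry. -/
lemma integral_sqrt_sum_sq_le (hX : ∀ i, Measurable (X i)) (hint : ∀ i, Integrable (X i) μ)
    (hI : iIndepFun X μ) (hS : ∀ i, IsSymmetricRV (X i) μ) :
    ∫ ω, √(∑ i, X i ω ^ 2) ∂μ ≤ √3 * ∫ ω, |∑ i, X i ω| ∂μ := by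
  set N : ℝ := (Fintype.card (ι → ℤˣ) : ℝ) with hN
  have hN0 : 0 < N := by rw [hN]; exact_mod_cast Fintype.card_pos
  have hi : ∀ θ : ι → ℤˣ, Integrable (fun ω => |∑ i, X i ω * unitSign (θ i)|) μ := fun θ =>
    (integrable_finsetSum _ fun i _ => (hint i).mul_const _).abs
  have h1 : ∫ ω, N * √(∑ i, X i ω ^ 2) ∂μ
      ≤ ∫ ω, √3 * ∑ θ : ι → ℤˣ, |∑ i, X i ω * unitSign (θ i)| ∂μ :=
    integral_mono ((integrable_sqrt_sum_sq hX hint _).const_mul N)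
      ((integrable_finsetSum _ fun θ _ => hi θ).const_mul _) fun ω => khinchine fun i => X i ω
  rw [integral_const_mul, integral_const_mul, integral_finsetSum _ fun θ _ => hi θ] at h1
  have h2 : ∀ θ : ι → ℤˣ, ∫ ω, |∑ i, X i ω * unitSign (θ i)| ∂μ = ∫ ω, |∑ i, X i ω| ∂μ := by
    intro θ
    rw [← integral_unitSign_mul hX hI hS θ (G := fun x => |∑ i, x i|) (by fun_prop)]
    simp only [mul_comm]
  rw [Finset.sum_congr rfl fun θ _ => h2 θ, Finset.sum_const, nsmul_eq_mul, Finset.card_univ,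
    ← hN] at h1
  refine le_of_mul_le_mul_left (h1.trans_eq ?_) hN0
  ring

/-- Orthogonality of truncated independent symmetric random variables. -/
lemma sq_integral_abs_sum_trunc_le (hX : ∀ i, Measurable (X i)) (hI : iIndepFun X μ)
    (hS : ∀ i, IsSymmetricRV (X i) μ) {K : ℝ} (hK : 0 ≤ K) (c : ι → ℝ) :
    (∫ ω, |∑ i, c i * trunc K (X i ω)| ∂μ) ^ 2
      ≤ ∑ i, c i ^ 2 * ∫ ω, trunc K (X i ω) ^ 2 ∂μ := by
  have hL : ∀ i, MemLp (fun ω => c i * trunc K (X i ω)) 2 μ := fun i =>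
    (memLp_trunc hX hK i 2).const_mul _
  refine (sq_integral_abs_le (memLp_finsetSum _ fun i _ => hL i)).trans_eq ?_
  simp only [sq (∑ i, c i * trunc K (X i _)), Finset.sum_mul_sum]
  have hint : ∀ i j, Integrable
      (fun ω => c i * trunc K (X i ω) * (c j * trunc K (X j ω))) μ := fun i j =>
    (hL i).integrable_mul (hL j)
  rw [integral_finsetSum _ fun i _ => integrable_finsetSum _ fun j _ => hint i j]
  refine Finset.sum_congr rfl fun i _ => ?_
  rw [integral_finsetSum _ fun j _ => hint i j, Finset.sum_eq_single i]
  · rw [← integral_const_mul]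
    congr 1; ext ω; ring
  · intro j _ hj
    refine integral_eq_zero_of_flipAt hX hI hS j
      (G := fun x => c i * trunc K (x i) * (c j * trunc K (x j))) ?_ fun x => ?_
    · have := measurable_trunc K
      fun_prop
    · rw [flipAt_of_ne (Ne.symm hj)]
      simp [flipAt, trunc_neg]
  · simp

end SymmetricVectors

/-! ### Spikes: a system biorthogonal, up to scaling, to the entries. -/

section Spikes

variable {ι : Type*}

/-- The sign of `x p` on the event that, among the coordinates in `U` and `p`, exactly the
coordinate `p` exceeds `K` in absolute value. -/
noncomputable def spike (U : Finset ι) (K : ℝ) (p : ι) (x : ι → ℝ) : ℝ :=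
  {x : ι → ℝ | K < |x p| ∧ ∀ q ∈ U, q ≠ p → |x q| ≤ K}.indicator
    (fun x => if 0 < x p then 1 else -1) x

lemma spike_of_mem {U : Finset ι} {K : ℝ} {p : ι} {x : ι → ℝ}
    (h : K < |x p| ∧ ∀ q ∈ U, q ≠ p → |x q| ≤ K) : spike U K p x = if 0 < x p then 1 else -1 :=
  Set.indicator_of_mem (s := {x : ι → ℝ | K < |x p| ∧ ∀ q ∈ U, q ≠ p → |x q| ≤ K}) h _

lemma spike_of_notMem {U : Finset ι} {K : ℝ} {p : ι} {x : ι → ℝ}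
    (h : ¬ (K < |x p| ∧ ∀ q ∈ U, q ≠ p → |x q| ≤ K)) : spike U K p x = 0 :=
  Set.indicator_of_notMem (s := {x : ι → ℝ | K < |x p| ∧ ∀ q ∈ U, q ≠ p → |x q| ≤ K}) h _

lemma abs_spike_le_one (U : Finset ι) (K : ℝ) (p : ι) (x : ι → ℝ) : |spike U K p x| ≤ 1 := by
  by_cases h : K < |x p| ∧ ∀ q ∈ U, q ≠ p → |x q| ≤ K
  · rw [spike_of_mem h]; split_ifs <;> simp
  · rw [spike_of_notMem h]; simp

/-- The events defining the spikes of different coordinates in `U` are disjoint. -/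
lemma sum_abs_spike_le_one (U : Finset ι) (K : ℝ) (x : ι → ℝ) :
    ∑ p ∈ U, |spike U K p x| ≤ 1 := by
  by_cases h : ∃ p ∈ U, spike U K p x ≠ 0
  · obtain ⟨p, hp, hne⟩ := h
    have hK : K < |x p| := by
      by_contra hc
      exact hne (spike_of_notMem fun h => hc h.1)
    rw [Finset.sum_eq_single_of_mem p hp]
    · exact abs_spike_le_one U K p x
    · intro q _ hqp
      have : ¬ (K < |x q| ∧ ∀ r ∈ U, r ≠ q → |x r| ≤ K) := fun h =>
        absurd (h.2 p hp hqp.symm) (not_le.2 hK)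
      rw [spike_of_notMem this, abs_zero]
  · push Not at h
    rw [Finset.sum_eq_zero fun p hp => by rw [h p hp, abs_zero]]
    exact zero_le_one

lemma measurable_spike [Countable ι] (U : Finset ι) (K : ℝ) (p : ι) :
    Measurable (spike U K p) := by
  refine Measurable.indicator (Measurable.ite (measurableSet_lt measurable_const
    (measurable_pi_apply p)) measurable_const measurable_const) ?_
  refine MeasurableSet.inter (measurableSet_lt measurable_const (measurable_pi_apply p).abs) ?_
  change MeasurableSet {x : ι → ℝ | ∀ q ∈ U, q ≠ p → |x q| ≤ K}
  simp only [Set.ofPred_forall]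
  exact MeasurableSet.iInter fun q => MeasurableSet.iInter fun _ => MeasurableSet.iInter fun _ =>
    measurableSet_le (measurable_pi_apply q).abs measurable_const

variable [DecidableEq ι]

lemma abs_flipAt (p q : ι) (x : ι → ℝ) : |flipAt p x q| = |x q| := by
  by_cases h : q = p <;> simp [flipAt, h]

/-- A spike depends on the other coordinates only through their absolute values. This makes its
product with any of them odd. -/
lemma spike_flipAt_of_ne {p q : ι} (h : p ≠ q) (U : Finset ι) (K : ℝ) (x : ι → ℝ) :
    spike U K p (flipAt q x) = spike U K p x := by
  simp only [spike, Set.indicator_apply, Set.mem_ofPred_eq, abs_flipAt, flipAt_of_ne h x]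

lemma mul_spike_self (U : Finset ι) {K : ℝ} (p : ι) (x : ι → ℝ) :
    x p * spike U K p x
      = excess K (x p) * {y : {q // q ∈ U.erase p} → ℝ | ∀ q, |y q| ≤ K}.indicator
        (fun _ => (1 : ℝ)) (fun q => x q) := by
  have hiff : (∀ q : {q // q ∈ U.erase p}, |x q| ≤ K) ↔ ∀ q ∈ U, q ≠ p → |x q| ≤ K := by
    constructor
    · exact fun h q hq hqp => h ⟨q, Finset.mem_erase.2 ⟨hqp, hq⟩⟩
    · exact fun h q => h q (Finset.mem_of_mem_erase q.2) (Finset.ne_of_mem_erase q.2)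
  simp only [Set.indicator_apply, Set.mem_ofPred_eq, hiff]
  unfold excess
  by_cases h1 : K < |x p| <;> by_cases h2 : ∀ q ∈ U, q ≠ p → |x q| ≤ K
  · rw [spike_of_mem ⟨h1, h2⟩, if_neg (not_le.2 h1), if_pos h2]
    split_ifs with h
    · rw [abs_of_pos h]
    · rw [abs_of_nonpos (not_lt.1 h)]; ring
  · rw [spike_of_notMem (fun h => h2 h.2), if_neg h2, mul_zero, mul_zero]
  · rw [spike_of_notMem (fun h => h1 h.1), if_pos (not_lt.1 h1), mul_zero, zero_mul]
  · rw [spike_of_notMem (fun h => h1 h.1), if_pos (not_lt.1 h1), mul_zero, zero_mul]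

variable {Ω : Type*} [MeasurableSpace Ω] {μ : Measure Ω} [IsProbabilityMeasure μ] {X : ι → Ω → ℝ}

/-- The excess of `X p` is independent of the event that the other coordinates in `U` stay below
`K`, and that event has probability at least `1 / 2`. -/
lemma integral_mul_spike_self_ge (hX : ∀ i, Measurable (X i)) (hI : iIndepFun X μ)
    {U : Finset ι} {K : ℝ} (hU : μ.real {ω | ∃ q ∈ U, K < |X q ω|} ≤ 1 / 2) (p : ι) :
    (∫ ω, excess K (X p ω) ∂μ) / 2 ≤ ∫ ω, X p ω * spike U K p (fun i => X i ω) ∂μ := by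
  rw [integral_congr_ae (ae_of_all μ fun ω => mul_spike_self U p fun i => X i ω)]
  set S : Set ({q // q ∈ U.erase p} → ℝ) := {y | ∀ q, |y q| ≤ K} with hSdef
  have hS : MeasurableSet S := by
    rw [hSdef, Set.ofPred_forall]
    exact MeasurableSet.iInter fun q => measurableSet_le (by fun_prop) (by fun_prop)
  have hm1 : Measurable (S.indicator fun _ => (1 : ℝ)) := measurable_const.indicator hS
  have hind := (hI.indepFun_finset {p} (U.erase p) (by simp) hX).comp
    (φ := fun x : ({p} : Finset ι) → ℝ => excess K (x ⟨p, by simp⟩))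
    ((measurable_excess K).comp (measurable_pi_apply _)) hm1
  have hm2 : Measurable fun ω (i : {q // q ∈ U.erase p}) => X i ω :=
    measurable_pi_lambda _ fun i => hX i
  have hmul := hind.integral_mul_eq_mul_integral
    ((measurable_excess K).comp (hX p)).aestronglyMeasurable (hm1.comp hm2).aestronglyMeasurable
  simp only [Pi.mul_apply, Function.comp_def] at hmul
  rw [hmul, div_eq_mul_one_div]
  refine mul_le_mul_of_nonneg_left ?_ (integral_nonneg fun _ => excess_nonneg _ _)
  have hset : MeasurableSet {ω | ∀ q : {q // q ∈ U.erase p}, |X q ω| ≤ K} := hm2 hS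
  have hB : MeasurableSet {ω | ∃ q ∈ U, K < |X q ω|} := by
    have : {ω | ∃ q ∈ U, K < |X q ω|} = ⋃ q ∈ U, {ω | K < |X q ω|} := by ext; simp
    rw [this]
    exact Finset.measurableSet_biUnion _ fun q _ =>
      measurableSet_lt measurable_const (hX q).abs
  have hint : ∫ ω, S.indicator (fun _ => (1 : ℝ)) (fun q => X q ω) ∂μ
      = μ.real {ω | ∀ q : {q // q ∈ U.erase p}, |X q ω| ≤ K} := by
    rw [← integral_indicator_one hset]
    rfl
  rw [hint]
  have hcompl := probReal_compl_eq_one_sub (μ := μ) hB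
  have hle : μ.real {ω | ∃ q ∈ U, K < |X q ω|}ᶜ
      ≤ μ.real {ω | ∀ q : {q // q ∈ U.erase p}, |X q ω| ≤ K} := by
    refine measureReal_mono fun ω hω q => ?_
    by_contra hc
    exact hω ⟨q, Finset.mem_of_mem_erase q.2, not_le.1 hc⟩
  linarith

lemma integral_mul_spike_of_ne [Fintype ι] (hX : ∀ i, Measurable (X i)) (hI : iIndepFun X μ)
    (hS : ∀ i, IsSymmetricRV (X i) μ) {p q : ι} (h : p ≠ q) (U : Finset ι) (K : ℝ) :
    ∫ ω, X q ω * spike U K p (fun i => X i ω) ∂μ = 0 := by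
  refine integral_eq_zero_of_flipAt hX hI hS q (G := fun x => x q * spike U K p x) ?_ fun x => ?_
  · exact (measurable_pi_apply q).mul (measurable_spike U K p)
  · rw [spike_flipAt_of_ne h]
    simp [flipAt]

end Spikes

/-! ### Arrays and the reduction to signed paths. -/

section Arrays

lemma norm_ellOne {k : ℕ} (x : EllOne k) : ‖x‖ = ∑ j, |x j| := by
  simp [PiLp.norm_eq_sum (p := 1) (by norm_num)]

lemma sum_abs_le_norm {m : ℕ} (x : EllInftyEllOne m) (i : Fin m) : ∑ j, |x i j| ≤ ‖x‖ := by
  rw [← norm_ellOne]; exact norm_le_pi_norm x i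

/-- The unit vector `e_j` of `ℓ₁^m`. -/
noncomputable def ellOneBasis {m : ℕ} (j : Fin m) : EllOne m := WithLp.toLp 1 (Pi.single j 1)

lemma norm_ellOneBasis {m : ℕ} (j : Fin m) : ‖ellOneBasis j‖ = 1 := by
  rw [norm_ellOne, Finset.sum_eq_single j] <;> simp +contextual [ellOneBasis]

lemma ellOne_eq_sum {m : ℕ} (x : EllOne m) : x = ∑ j, x j • ellOneBasis j := by
  ext l
  simp [ellOneBasis, Pi.single_apply]

lemma array_eq_sum {m : ℕ} (x : EllInftyEllOne m) : x = ∑ i, ∑ j, x i j • unitVec i j := by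
  ext i l
  simp [unitVec, Pi.single_apply, apply_ite]

variable {E F : Type*} [NormedAddCommGroup E] [NormedSpace ℝ E] [NormedAddCommGroup F]
  [NormedSpace ℝ F]

lemma map_array {m : ℕ} (T : EllInftyEllOne m →L[ℝ] F) (x : EllInftyEllOne m) :
    T x = ∑ i, ∑ j, x i j • T (unitVec i j) := by
  conv_lhs => rw [array_eq_sum x]
  simp [map_sum]

/-- The vector is a convex combination of `a` and the points `a ± b j`, and `a` is itself the
midpoint of such a pair. -/
lemma norm_add_sum_smul_le {ι : Type*} [Fintype ι] [Nonempty ι] {a : F} {b : ι → F} {c : ι → ℝ}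
    {M : ℝ} (hc : ∑ j, |c j| ≤ 1) (hp : ∀ j, ‖a + b j‖ ≤ M) (hn : ∀ j, ‖a - b j‖ ≤ M) :
    ‖a + ∑ j, c j • b j‖ ≤ M := by
  have ha : ‖a‖ ≤ M := by
    obtain ⟨j⟩ := ‹Nonempty ι›
    have h : a = (1 / 2 : ℝ) • ((a + b j) + (a - b j)) := by module
    calc ‖a‖ = ‖(1 / 2 : ℝ) • ((a + b j) + (a - b j))‖ := by rw [← h]
      _ = 1 / 2 * ‖(a + b j) + (a - b j)‖ := by rw [norm_smul]; norm_num
      _ ≤ 1 / 2 * (M + M) := by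
        gcongr; exact (norm_add_le _ _).trans (add_le_add (hp j) (hn j))
      _ = M := by ring
  have h1 : ∀ j, ‖|c j| • a + c j • b j‖ ≤ |c j| * M := fun j => by
    rcases le_total 0 (c j) with h | h
    · rw [abs_of_nonneg h, ← smul_add, norm_smul, Real.norm_of_nonneg h]
      exact mul_le_mul_of_nonneg_left (hp j) h
    · rw [abs_of_nonpos h, show -c j • a + c j • b j = (-c j) • (a - b j) by module, norm_smul,
        Real.norm_of_nonneg (neg_nonneg.2 h)]
      exact mul_le_mul_of_nonneg_left (hn j) (neg_nonneg.2 h)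
  have h2 : a + ∑ j, c j • b j = (1 - ∑ j, |c j|) • a + ∑ j, (|c j| • a + c j • b j) := by
    rw [Finset.sum_add_distrib, ← Finset.sum_smul]; module
  rw [h2]
  calc ‖(1 - ∑ j, |c j|) • a + ∑ j, (|c j| • a + c j • b j)‖
      ≤ (1 - ∑ j, |c j|) * M + ∑ j, |c j| * M := by
        refine (norm_add_le _ _).trans (add_le_add ?_ ((norm_sum_le _ _).trans
          (Finset.sum_le_sum fun j _ => h1 j)))
        rw [norm_smul, Real.norm_of_nonneg (by linarith)]
        exact mul_le_mul_of_nonneg_left ha (by linarith)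
    _ = M := by rw [← Finset.sum_mul]; ring

/-- The norm of an operator on `ℓ_∞^m(ℓ₁^m)` is attained at the arrays with one entry `±1` in
each row. -/
lemma norm_le_of_signed_paths {m : ℕ} (T : EllInftyEllOne m →L[ℝ] F) {M : ℝ}
    (hM : ∀ (j : Fin m → Fin m) (u : Fin m → ℤˣ),
      ‖T fun i => unitSign (u i) • ellOneBasis (j i)‖ ≤ M)
    (s : Finset (Fin m)) (y : EllInftyEllOne m) (hs : ∀ i ∈ s, ‖y i‖ ≤ 1)
    (hns : ∀ i ∉ s, ∃ (j : Fin m) (u : ℤˣ), y i = unitSign u • ellOneBasis j) : ‖T y‖ ≤ M := by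
  -- The rows in `s` are still arbitrary. Each step expands one of them in the basis of `ℓ₁^m` and
  -- replaces it by signed unit vectors.
  induction s using Finset.induction_on generalizing y with
  | empty =>
    choose j u h using fun i => hns i (Finset.notMem_empty i)
    have : y = fun i => unitSign (u i) • ellOneBasis (j i) := funext h
    rw [this]; exact hM j u
  | insert p s hp ih =>
    have hupd : ∀ z : EllOne m, T (Function.update y p z)
        = T (Function.update y p 0) + T (Pi.single p z) := fun z => by
      rw [← map_add]; congr 1
      ext i : 1
      by_cases h : i = p
      · subst h; simp
      · simp [h]
    have hkey : ∀ (j : Fin m) (u : ℤˣ),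
        ‖T (Function.update y p (unitSign u • ellOneBasis j))‖ ≤ M := fun j u => by
      refine ih _ (fun i hi => ?_) fun i hi => ?_
      · rw [Function.update_of_ne (ne_of_mem_of_not_mem hi hp)]
        exact hs i (Finset.mem_insert_of_mem hi)
      · by_cases h : i = p
        · subst h; exact ⟨j, u, by simp⟩
        · rw [Function.update_of_ne h]
          exact hns i fun hmem => (Finset.mem_insert.1 hmem).elim h hi
    have hexp : T y = T (Function.update y p 0) + ∑ j, y p j • T (Pi.single p (ellOneBasis j)) := by
      have h1 : Pi.single p (y p) = ∑ j, y p j • (Pi.single p (ellOneBasis j) : EllInftyEllOne m) := by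
        conv_lhs => rw [ellOne_eq_sum (y p)]
        ext i : 1
        by_cases h : i = p
        · subst h; simp
        · simp [h]
      conv_lhs => rw [← Function.update_eq_self p y, hupd, h1]
      simp [map_sum]
    rw [hexp]
    have : Nonempty (Fin m) := ⟨p⟩
    refine norm_add_sum_smul_le ?_ (fun j => ?_) fun j => ?_
    · rw [← norm_ellOne]; exact hs p (Finset.mem_insert_self _ _)
    · have := hkey j 1
      rw [hupd] at this
      simpa [unitSign] using this
    · have := hkey j (-1)
      rw [hupd] at this
      simpa [unitSign, Pi.single_neg, sub_eq_add_neg] using this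

end Arrays

/-! ### The norm formula and the square function of a path. -/

section RandomMatrix

lemma norm_sum_smul_LOne {ι : Type*} (s : Finset ι) (c : ι → ℝ) (f : ι → LOne) :
    ‖∑ p ∈ s, c p • f p‖ = ∫ ω, |∑ p ∈ s, c p * f p ω| := by
  rw [L1.norm_eq_integral_norm]
  refine integral_congr_ae ?_
  have h : ∀ᵐ ω, ∀ p ∈ s, (c p • f p) ω = c p * f p ω := by
    rw [Finset.eventually_all]
    intro p _
    filter_upwards [Lp.coeFn_smul (c p) (f p)] with ω hω
    simp [hω]
  filter_upwards [Lp.coeFn_finsetSum s fun p => c p • f p, h] with ω h1 h2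
  rw [h1, Finset.sum_apply, Real.norm_eq_abs, Finset.sum_congr rfl h2]

variable {m : ℕ} (T : EllInftyEllOne m →L[ℝ] LOne)

lemma measurable_matrixEntry (i j : Fin m) : Measurable (matrixEntry T i j) :=
  (Lp.stronglyMeasurable _).measurable

lemma integrable_matrixEntry (i j : Fin m) : Integrable (matrixEntry T i j) :=
  L1.integrable_coeFn _

variable {T}

lemma norm_path_le_one (j : Fin m → Fin m) (c : Fin m → ℝ) (hc : ∀ i, |c i| ≤ 1) :
    ‖(fun i => c i • ellOneBasis (j i) : EllInftyEllOne m)‖ ≤ 1 := by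
  refine (pi_norm_le_iff_of_nonneg zero_le_one).2 fun i => ?_
  rw [norm_smul, norm_ellOneBasis, mul_one]; exact hc i

lemma norm_map_path (j : Fin m → Fin m) (c : Fin m → ℝ) :
    ‖T fun i => c i • ellOneBasis (j i)‖ = ∫ ω, |∑ i, c i * matrixEntry T i (j i) ω| := by
  refine Eq.trans ?_ (norm_sum_smul_LOne Finset.univ c fun i => T (unitVec i (j i)))
  congr 1
  simp only [← map_smul]
  rw [← map_sum]
  congr 1
  ext i : 1
  simp [unitVec, ellOneBasis, Finset.sum_apply, Pi.single_apply]

lemma iIndepFun_path (hI : iIndepFun (fun p : Fin m × Fin m => matrixEntry T p.1 p.2) volume)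
    (j : Fin m → Fin m) : iIndepFun (fun i => matrixEntry T i (j i)) volume :=
  hI.precomp (g := fun i => (i, j i)) fun _ _ h => (Prod.ext_iff.1 h).1

theorem isGreatest_norm
    (hI : iIndepFun (fun p : Fin m × Fin m => matrixEntry T p.1 p.2) volume)
    (hS : ∀ i j, IsSymmetricRV (matrixEntry T i j) volume) :
    IsGreatest (Set.range fun j : Fin m → Fin m => ∫ ω, |∑ i, matrixEntry T i (j i) ω|) ‖T‖ := by
  have hle : ∀ j : Fin m → Fin m, ∫ ω, |∑ i, matrixEntry T i (j i) ω| ≤ ‖T‖ := fun j => by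
    have h := T.le_of_opNorm_le_of_le le_rfl (norm_path_le_one j (fun _ => 1) fun _ => by simp)
    rw [norm_map_path] at h
    simpa using h
  refine ⟨?_, by rintro _ ⟨j, rfl⟩; exact hle j⟩
  have : Nonempty (Fin m → Fin m) := ⟨id⟩
  obtain ⟨j₀, hj₀⟩ := Finite.exists_max fun j : Fin m → Fin m =>
    ∫ ω, |∑ i, matrixEntry T i (j i) ω|
  refine ⟨j₀, le_antisymm (hle j₀) ?_⟩
  have hM0 : 0 ≤ ∫ ω, |∑ i, matrixEntry T i (j₀ i) ω| := integral_nonneg fun _ => abs_nonneg _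
  refine T.opNorm_le_of_unit_norm hM0 fun x hx => ?_
  refine norm_le_of_signed_paths T (fun j u => ?_) Finset.univ x
    (fun i _ => hx ▸ norm_le_pi_norm x i) fun i hi => absurd (Finset.mem_univ i) hi
  rw [norm_map_path, integral_unitSign_mul (X := fun i => matrixEntry T i (j i))
    (fun i => measurable_matrixEntry T _ _) (iIndepFun_path hI j) (fun i => hS _ _) u
    (G := fun x => |∑ i, x i|) (by fun_prop)]
  exact hj₀ j

lemma integral_sqrt_path_le
    (hI : iIndepFun (fun p : Fin m × Fin m => matrixEntry T p.1 p.2) volume)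
    (hS : ∀ i j, IsSymmetricRV (matrixEntry T i j) volume) (hT : ‖T‖ ≤ 1) (j : Fin m → Fin m) :
    ∫ ω, √(∑ i, matrixEntry T i (j i) ω ^ 2) ≤ √3 := by
  refine (integral_sqrt_sum_sq_le (fun i => measurable_matrixEntry T i (j i))
    (fun i => integrable_matrixEntry T i (j i)) (iIndepFun_path hI j) fun i => hS _ _).trans ?_
  have : ∫ ω, |∑ i, matrixEntry T i (j i) ω| ≤ 1 :=
    ((isGreatest_norm hI hS).2 ⟨j, rfl⟩).trans hT
  nlinarith [Real.sqrt_nonneg 3]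

end RandomMatrix

/-! ### The two alternatives exclude each other. -/

section Incompatibility

/-- Orlicz's inequality: columns of an operator `ℓ_∞^n → ℓ₁^k`. -/
lemma sum_sqrt_sum_sq_le {n k : ℕ} (V : EllInfty n →L[ℝ] EllOne k) :
    ∑ l, √(∑ i, V (Pi.single l 1) i ^ 2) ≤ √3 * ‖V‖ := by
  set N : ℝ := (Fintype.card (Fin k → ℤˣ) : ℝ) with hN
  have hN0 : 0 < N := by rw [hN]; exact_mod_cast Fintype.card_pos
  have hθ : ∀ θ : Fin k → ℤˣ,
      ∑ l, |∑ i, V (Pi.single l 1) i * unitSign (θ i)| ≤ ‖V‖ := fun θ => by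
    set b : Fin n → ℝ := fun l => ∑ i, V (Pi.single l 1) i * unitSign (θ i) with hb
    -- Testing `V` on the signs of `b` turns the `ℓ₁` norm of `b` into a signed sum of the
    -- coordinates of `V x`.
    set x : EllInfty n := fun l => (SignType.sign (b l) : ℝ) with hx
    have hx1 : ‖x‖ ≤ 1 := (pi_norm_le_iff_of_nonneg zero_le_one).2 fun l => by
      simp only [hx]
      rcases lt_trichotomy (b l) 0 with h | h | h <;> simp [h]
    have hVx : V x = ∑ l, x l • V (Pi.single l 1) := by
      conv_lhs => rw [pi_eq_sum_univ' x]
      simp [map_sum]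
    calc ∑ l, |b l| = ∑ i, V x i * unitSign (θ i) := by
          rw [hVx]
          simp only [WithLp.ofLp_sum, Finset.sum_apply, PiLp.smul_apply,
            smul_eq_mul, Finset.sum_mul]
          rw [Finset.sum_comm]
          refine Finset.sum_congr rfl fun l _ => ?_
          rw [← sign_mul_self (b l), hb, Finset.mul_sum]
          exact Finset.sum_congr rfl fun i _ => by simp only [hx, hb]; ring
      _ ≤ ∑ i, |V x i| := Finset.sum_le_sum fun i _ => by
          refine (le_abs_self _).trans_eq ?_
          rw [abs_mul, abs_unitSign, mul_one]
      _ = ‖V x‖ := (norm_ellOne _).symm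
      _ ≤ ‖V‖ := by simpa using V.le_of_opNorm_le_of_le le_rfl hx1
  refine le_of_mul_le_mul_left ?_ hN0
  calc N * ∑ l, √(∑ i, V (Pi.single l 1) i ^ 2)
      ≤ ∑ l, √3 * ∑ θ : Fin k → ℤˣ, |∑ i, V (Pi.single l 1) i * unitSign (θ i)| := by
        rw [Finset.mul_sum]
        exact Finset.sum_le_sum fun l _ => khinchine _
    _ = √3 * ∑ θ : Fin k → ℤˣ, ∑ l, |∑ i, V (Pi.single l 1) i * unitSign (θ i)| := by
        rw [← Finset.mul_sum, Finset.sum_comm]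
    _ ≤ √3 * ∑ _θ : Fin k → ℤˣ, ‖V‖ := by
        gcongr with θ; exact hθ θ
    _ = N * (√3 * ‖V‖) := by
        rw [Finset.sum_const, nsmul_eq_mul, Finset.card_univ]; ring

/-- `ℓ₁^k` is not uniformly complemented in `ℓ_∞^n`. -/
lemma card_le_of_approx_id {n k : ℕ} (U : EllOne k →L[ℝ] EllInfty n)
    (V : EllInfty n →L[ℝ] EllOne k)
    (h : ‖ContinuousLinearMap.id ℝ (EllOne k) - V ∘L U‖ ≤ 1 / 2) :
    (k : ℝ) ≤ 12 * (‖V‖ * ‖U‖) ^ 2 := by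
  have hVU : ∀ i, V (U (ellOneBasis i)) = ∑ l, U (ellOneBasis i) l • V (Pi.single l 1) :=
    fun i => by
      conv_lhs => rw [pi_eq_sum_univ' (U (ellOneBasis i))]
      simp [map_sum]
  have hdiag : ∀ i, 1 / 2 ≤ V (U (ellOneBasis i)) i := fun i => by
    have h1 := (ContinuousLinearMap.id ℝ (EllOne k) - V ∘L U).le_of_opNorm_le h (ellOneBasis i)
    rw [norm_ellOneBasis, norm_ellOne] at h1
    have h2 := Finset.single_le_sum
      (f := fun j => |(ContinuousLinearMap.id ℝ (EllOne k) - V ∘L U) (ellOneBasis i) j|)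
      (fun j _ => abs_nonneg _) (Finset.mem_univ i)
    have h3 := (le_abs_self _).trans (h2.trans h1)
    have h4 : (ContinuousLinearMap.id ℝ (EllOne k) - V ∘L U) (ellOneBasis i) i
        = 1 - V (U (ellOneBasis i)) i := by
      simp [ellOneBasis]
    linarith
  have hU : ∀ i l, |U (ellOneBasis i) l| ≤ ‖U‖ := fun i l => by
    have h1 := U.le_opNorm (ellOneBasis i)
    rw [norm_ellOneBasis, mul_one] at h1
    exact (norm_le_pi_norm (U (ellOneBasis i)) l).trans h1
  have hrow : ∀ l, ∑ i, U (ellOneBasis i) l * V (Pi.single l 1) i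
      ≤ (√k * ‖U‖) * √(∑ i, V (Pi.single l 1) i ^ 2) := fun l => by
    refine (Real.sum_mul_le_sqrt_mul_sqrt _ _ _).trans
      (mul_le_mul_of_nonneg_right ?_ (Real.sqrt_nonneg _))
    refine Real.sqrt_le_iff.2 ⟨by positivity, ?_⟩
    rw [mul_pow, Real.sq_sqrt (Nat.cast_nonneg k)]
    calc ∑ i, U (ellOneBasis i) l ^ 2 ≤ ∑ _i : Fin k, ‖U‖ ^ 2 :=
          Finset.sum_le_sum fun i _ => sq_le_sq.2 ((hU i l).trans (le_abs_self _))
      _ = k * ‖U‖ ^ 2 := by simp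
  -- The trace of `V ∘L U` is at least `k / 2`. Computed through `ℓ_∞^n`, it is of order `√k` by
  -- Cauchy–Schwarz and Orlicz's inequality.
  have hmain : (k : ℝ) / 2 ≤ (√k * ‖U‖) * (√3 * ‖V‖) := by
    calc (k : ℝ) / 2 = ∑ _i : Fin k, (1 / 2 : ℝ) := by simp; ring
      _ ≤ ∑ i, V (U (ellOneBasis i)) i := Finset.sum_le_sum fun i _ => hdiag i
      _ = ∑ l, ∑ i, U (ellOneBasis i) l * V (Pi.single l 1) i := by
          rw [Finset.sum_comm]
          refine Finset.sum_congr rfl fun i _ => ?_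
          rw [hVU i]
          simp
      _ ≤ ∑ l, (√k * ‖U‖) * √(∑ i, V (Pi.single l 1) i ^ 2) :=
          Finset.sum_le_sum fun l _ => hrow l
      _ ≤ (√k * ‖U‖) * (√3 * ‖V‖) := by
          rw [← Finset.mul_sum]; gcongr; exact sum_sqrt_sum_sq_le V
  have hk : √(k : ℝ) ^ 2 = k := Real.sq_sqrt (Nat.cast_nonneg k)
  have h3 : √(3 : ℝ) ^ 2 = 3 := Real.sq_sqrt (by norm_num)
  rcases (Real.sqrt_nonneg (k : ℝ)).eq_or_lt with h0 | hpos
  · have hk0 : (k : ℝ) = 0 := by rw [← hk, ← h0]; simp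
    rw [hk0]; positivity
  · have h4 : √(k : ℝ) ≤ 2 * (√3 * (‖V‖ * ‖U‖)) := by
      refine le_of_mul_le_mul_left ?_ hpos
      rw [← sq, hk]; linarith
    calc (k : ℝ) = √(k : ℝ) ^ 2 := hk.symm
      _ ≤ (2 * (√3 * (‖V‖ * ‖U‖))) ^ 2 := by gcongr
      _ = 4 * √3 ^ 2 * (‖V‖ * ‖U‖) ^ 2 := by ring
      _ = 12 * (‖V‖ * ‖U‖) ^ 2 := by rw [h3]; ring

theorem not_uniformlyApproxFactorThrough {I : Type*} {E F : I → Type*}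
    [∀ i, NormedAddCommGroup (E i)] [∀ i, NormedSpace ℝ (E i)]
    [∀ i, NormedAddCommGroup (F i)] [∀ i, NormedSpace ℝ (F i)] (T : ∀ i, E i →L[ℝ] F i)
    (h : UniformlyFactorThrough (fun k : ℕ => ContinuousLinearMap.id ℝ (EllOne k)) T) :
    ¬ UniformlyApproxFactorThrough T (fun k : ℕ => ContinuousLinearMap.id ℝ (EllInfty k)) := by
  intro h'
  obtain ⟨C, hC, h⟩ := h
  -- With this accuracy, composing the error with `A` and `B` leaves a distance of at most `1 / 2`
  -- from the identity.
  obtain ⟨D, hD, h'⟩ := h' (1 / (2 * C)) (by positivity)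
  obtain ⟨k, hk⟩ := exists_nat_gt (12 * (C * D) ^ 2)
  obtain ⟨m, A, B, hAB, hnAB⟩ := h k
  change ContinuousLinearMap.id ℝ (EllOne k) = _ at hAB
  obtain ⟨n, A', B', hT, hnAB'⟩ := h' m
  refine absurd (card_le_of_approx_id (A' ∘L A) (B ∘L B') ?_) (not_le.2 (hk.trans_le' ?_))
  · have heq : ContinuousLinearMap.id ℝ (EllOne k) - (B ∘L B') ∘L (A' ∘L A)
        = B ∘L (T m - B' ∘L ContinuousLinearMap.id ℝ (EllInfty n) ∘L A') ∘L A := by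
      rw [hAB]; ext x; simp
    rw [heq]
    calc _ ≤ ‖B‖ * (‖T m - B' ∘L ContinuousLinearMap.id ℝ (EllInfty n) ∘L A'‖ * ‖A‖) :=
          (ContinuousLinearMap.opNorm_comp_le _ _).trans
            (mul_le_mul_of_nonneg_left (ContinuousLinearMap.opNorm_comp_le _ _) (norm_nonneg _))
      _ ≤ ‖B‖ * (1 / (2 * C) * ‖A‖) := by gcongr
      _ = (‖A‖ * ‖B‖) * (1 / (2 * C)) := by ring
      _ ≤ C * (1 / (2 * C)) := by gcongr
      _ = 1 / 2 := by field_simp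
  · refine mul_le_mul_of_nonneg_left (pow_le_pow_left₀ (by positivity) ?_ 2) (by norm_num)
    calc ‖B ∘L B'‖ * ‖A' ∘L A‖ ≤ (‖B‖ * ‖B'‖) * (‖A'‖ * ‖A‖) := by
          gcongr <;> exact ContinuousLinearMap.opNorm_comp_le _ _
      _ = (‖A‖ * ‖B‖) * (‖A'‖ * ‖B'‖) := by ring
      _ ≤ C * D := by gcongr

end Incompatibility

/-! ### Factoring the identity of `ℓ₁^k` through the random matrix. -/

section IdentityFactorization

lemma integrable_LOne_mul {h : unitInterval → ℝ} (hm : Measurable h) {M : ℝ}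
    (hM : ∀ ω, |h ω| ≤ M) (f : LOne) : Integrable fun ω => f ω * h ω :=
  (L1.integrable_coeFn f).mul_bdd (c := M) hm.aestronglyMeasurable (ae_of_all _ hM)

/-- Integration against functions `h₁, …, h_k` with `∑ |h_s| ≤ M` is an operator `L₁ → ℓ₁^k`
of norm at most `M`. -/
lemma exists_integral_operator {k : ℕ} (h : Fin k → unitInterval → ℝ)
    (hm : ∀ s, Measurable (h s)) {M : ℝ} (hM0 : 0 ≤ M) (hM : ∀ ω, ∑ s, |h s ω| ≤ M) :
    ∃ B : LOne →L[ℝ] EllOne k, (∀ f s, B f s = ∫ ω, f ω * h s ω) ∧ ‖B‖ ≤ M := by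
  have hs : ∀ s ω, |h s ω| ≤ M := fun s ω =>
    (Finset.single_le_sum (f := fun s => |h s ω|) (fun _ _ => abs_nonneg _)
      (Finset.mem_univ s)).trans (hM ω)
  have hint := fun s f => integrable_LOne_mul (hm s) (hs s) f
  let L : LOne →ₗ[ℝ] EllOne k :=
    { toFun := fun f => WithLp.toLp 1 fun s => ∫ ω, f ω * h s ω
      map_add' := fun f g => by
        ext s
        change ∫ ω, (f + g) ω * h s ω = (∫ ω, f ω * h s ω) + ∫ ω, g ω * h s ω
        rw [← integral_add (hint s f) (hint s g)]
        refine integral_congr_ae ?_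
        filter_upwards [Lp.coeFn_add f g] with ω hω
        rw [hω, Pi.add_apply]; ring
      map_smul' := fun c f => by
        ext s
        change ∫ ω, (c • f) ω * h s ω = c * ∫ ω, f ω * h s ω
        rw [← integral_const_mul]
        refine integral_congr_ae ?_
        filter_upwards [Lp.coeFn_smul c f] with ω hω
        rw [hω, Pi.smul_apply, smul_eq_mul]; ring }
  refine ⟨L.mkContinuous M fun f => ?_, fun f s => rfl, L.mkContinuous_norm_le hM0 _⟩
  rw [norm_ellOne, L1.norm_eq_integral_norm, ← integral_const_mul]
  calc ∑ s, |∫ ω, f ω * h s ω| ≤ ∑ s, ∫ ω, |f ω * h s ω| :=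
        Finset.sum_le_sum fun s _ => abs_integral_le_integral_abs
    _ = ∫ ω, ∑ s, |f ω * h s ω| := (integral_finsetSum _ fun s _ => (hint s f).abs).symm
    _ ≤ ∫ ω, M * ‖f ω‖ := by
        refine integral_mono (integrable_finsetSum _ fun s _ => (hint s f).abs)
          ((L1.integrable_coeFn f).norm.const_mul M) fun ω => ?_
        simp only [abs_mul, ← Finset.mul_sum, Real.norm_eq_abs]
        rw [mul_comm]
        exact mul_le_mul_of_nonneg_right (hM ω) (abs_nonneg _)

lemma exists_operator_of_basis {k : ℕ} {E : Type*} [NormedAddCommGroup E] [NormedSpace ℝ E]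
    (v : Fin k → E) (hv : ∀ s, ‖v s‖ ≤ 1) :
    ∃ A : EllOne k →L[ℝ] E, (∀ z, A z = ∑ s, z s • v s) ∧ ‖A‖ ≤ 1 := by
  let L : EllOne k →ₗ[ℝ] E :=
    { toFun := fun z => ∑ s, z s • v s
      map_add' := fun z w => by simp [add_smul, Finset.sum_add_distrib]
      map_smul' := fun c z => by simp [Finset.smul_sum, mul_smul] }
  refine ⟨L.mkContinuous 1 fun z => ?_, fun z => rfl, L.mkContinuous_norm_le zero_le_one _⟩
  rw [norm_ellOne, one_mul]
  change ‖∑ s, z s • v s‖ ≤ _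
  refine (norm_sum_le _ _).trans (Finset.sum_le_sum fun s _ => ?_)
  rw [norm_smul, Real.norm_eq_abs]
  exact mul_le_of_le_one_right (abs_nonneg _) (hv s)

/-- Disjoint paths whose entries have large excess over a high level span a well complemented
copy of `ℓ₁^k`. -/
lemma exists_factorization_id {m k : ℕ} {T : EllInftyEllOne m →L[ℝ] LOne}
    (hI : iIndepFun (fun p : Fin m × Fin m => matrixEntry T p.1 p.2) volume)
    (hS : ∀ i j, IsSymmetricRV (matrixEntry T i j) volume) (hT : ‖T‖ ≤ 1) {ε : ℝ} (hε : 0 < ε)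
    (j : Fin k → Fin m → Fin m) (hj : ∀ i, Function.Injective fun s => j s i)
    (hex : ∀ s, ε ≤ ∑ i, ∫ ω, excess (4 * k) (matrixEntry T i (j s i) ω)) :
    ∃ (A : EllOne k →L[ℝ] EllInftyEllOne m) (B : LOne →L[ℝ] EllOne k),
      ContinuousLinearMap.id ℝ (EllOne k) = B ∘L T ∘L A ∧ ‖A‖ * ‖B‖ ≤ 2 / ε := by
  let X : Fin m × Fin m → unitInterval → ℝ := fun p => matrixEntry T p.1 p.2
  have hX : ∀ p, Measurable (X p) := fun p => measurable_matrixEntry T _ _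
  have hint : ∀ p, Integrable (X p) := fun p => integrable_matrixEntry T _ _
  let e : Fin k × Fin m → Fin m × Fin m := fun q => (q.2, j q.1 q.2)
  have he : Function.Injective e := by
    rintro ⟨s, i⟩ ⟨t, l⟩ h
    obtain ⟨rfl, h2⟩ := Prod.ext_iff.1 h
    exact Prod.ext (hj i h2) rfl
  let U : Finset (Fin m × Fin m) := Finset.univ.image e
  -- Each of the `k` paths contributes at most `√3 / (4 * k)`; this is why the level is `4 * k`.
  have hU : volume.real {ω | ∃ q ∈ U, (4 * k : ℝ) < |X q ω|} ≤ 1 / 2 := by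
    rcases Nat.eq_zero_or_pos k with rfl | hk
    · have : {ω | ∃ q ∈ U, (4 * ((0 : ℕ) : ℝ)) < |X q ω|} = ∅ := by
        ext ω; simp [U]
      rw [this]; simp
    have hk' : (0 : ℝ) < k := by exact_mod_cast hk
    have hsub : {ω | ∃ q ∈ U, (4 * k : ℝ) < |X q ω|}
        ⊆ ⋃ s ∈ (Finset.univ : Finset (Fin k)),
          {ω | ∃ i ∈ (Finset.univ : Finset (Fin m)), (4 * k : ℝ) < |matrixEntry T i (j s i) ω|} := by
      rintro ω ⟨q, hq, hqω⟩
      obtain ⟨⟨s, i⟩, -, rfl⟩ := Finset.mem_image.1 hq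
      exact Set.mem_biUnion (Finset.mem_univ s) ⟨i, Finset.mem_univ i, hqω⟩
    calc _ ≤ _ := measureReal_mono hsub (measure_ne_top _ _)
      _ ≤ ∑ s : Fin k, _ := measureReal_biUnion_finset_le _ _
      _ ≤ ∑ _s : Fin k, √3 / (4 * k) := Finset.sum_le_sum fun s _ =>
          measureReal_exists_gt_le (fun i => measurable_matrixEntry T i (j s i))
            (fun i => integrable_matrixEntry T i (j s i)) Finset.univ (by positivity)
            (integral_sqrt_path_le hI hS hT (j s))
      _ = √3 / 4 := by
          rw [Finset.sum_const, Finset.card_univ, Fintype.card_fin, nsmul_eq_mul]; field_simp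
      _ ≤ 1 / 2 := by
          have : √(3 : ℝ) ≤ 2 := Real.sqrt_le_iff.2 ⟨by norm_num, by norm_num⟩
          linarith
  let sp : Fin m × Fin m → unitInterval → ℝ := fun p ω => spike U (4 * k) p fun q => X q ω
  have hsp : ∀ p, Measurable (sp p) := fun p =>
    (measurable_spike U (4 * k) p).comp (measurable_pi_lambda _ hX)
  let d : Fin k → ℝ := fun s => ∑ i, ∫ ω, X (i, j s i) ω * sp (i, j s i) ω
  have hd : ∀ s, ε / 2 ≤ d s := fun s => by
    calc ε / 2 ≤ (∑ i, ∫ ω, excess (4 * k) (X (i, j s i) ω)) / 2 := by gcongr; exact hex s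
      _ = ∑ i, (∫ ω, excess (4 * k) (X (i, j s i) ω)) / 2 := Finset.sum_div _ _ _
      _ ≤ d s := Finset.sum_le_sum fun i _ => integral_mul_spike_self_ge hX hI hU _
  have hd0 : ∀ s, 0 < d s := fun s => (half_pos hε).trans_le (hd s)
  have hspint : ∀ p q, Integrable fun ω => X p ω * sp q ω := fun p q =>
    (hint p).mul_bdd (c := 1) (hsp q).aestronglyMeasurable
      (ae_of_all _ fun ω => abs_spike_le_one _ _ _ _)
  obtain ⟨B, hB, hBn⟩ := exists_integral_operator (fun s ω => (∑ i, sp (i, j s i) ω) / d s)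
    (fun s => (Finset.measurable_sum _ fun i _ => hsp _).div_const _) (M := 2 / ε) (by positivity)
    (fun ω => by
      calc ∑ s, |(∑ i, sp (i, j s i) ω) / d s|
          ≤ ∑ s, (2 / ε) * ∑ i, |sp (e (s, i)) ω| := Finset.sum_le_sum fun s _ => by
            rw [abs_div, abs_of_pos (hd0 s), div_eq_mul_inv, mul_comm]
            gcongr
            · rw [← inv_div]; exact inv_anti₀ (half_pos hε) (hd s)
            · exact Finset.abs_sum_le_sum_abs _ _
        _ = (2 / ε) * ∑ p ∈ U, |sp p ω| := by
            rw [← Finset.mul_sum, Finset.sum_image he.injOn, Fintype.sum_prod_type]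
        _ ≤ (2 / ε) * 1 := by
            gcongr; exact sum_abs_spike_le_one _ _ _
        _ = 2 / ε := mul_one _)
  obtain ⟨A, hA, hAn⟩ := exists_operator_of_basis
    (fun s => (fun i => (1 : ℝ) • ellOneBasis (j s i) : EllInftyEllOne m))
    fun s => norm_path_le_one (j s) (fun _ => 1) fun _ => by simp
  have hBT : ∀ s t, B (T fun i => (1 : ℝ) • ellOneBasis (j s i)) t = if s = t then 1 else 0 := by
    intro s t
    have hpath : (fun i => (1 : ℝ) • ellOneBasis (j s i) : EllInftyEllOne m)
        = ∑ i, unitVec i (j s i) := by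
      ext i : 1
      simp [unitVec, ellOneBasis, Finset.sum_apply, Pi.single_apply]
    have hent : ∀ i, B (T (unitVec i (j s i))) t
        = (∑ l, ∫ ω, X (i, j s i) ω * sp (l, j t l) ω) / d t := fun i => by
      rw [hB, ← integral_finsetSum _ fun l _ => hspint _ _, ← integral_div]
      congr 1; ext ω
      rw [← Finset.mul_sum, mul_div_assoc]; rfl
    rw [hpath, map_sum, map_sum]
    simp only [WithLp.ofLp_sum, Finset.sum_apply, hent]
    rw [← Finset.sum_div]
    -- Disjointness of the paths, in the form `he`, makes distinct indices give distinct entries, so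
    -- all cross terms vanish and only the normalisation `d` survives.
    have hz : ∀ i l, (s, i) ≠ (t, l) → ∫ ω, X (i, j s i) ω * sp (l, j t l) ω = 0 := fun i l h =>
      integral_mul_spike_of_ne hX hI (fun p => hS _ _) (fun h' => h (he h').symm) U _
    split_ifs with hst
    · subst hst
      rw [div_eq_one_iff_eq (hd0 s).ne']
      refine Finset.sum_congr rfl fun i _ => ?_
      rw [Finset.sum_eq_single_of_mem i (Finset.mem_univ i)]
      intro l _ hl
      exact hz i l fun h => hl (Prod.ext_iff.1 h).2.symm
    · rw [Finset.sum_eq_zero fun i _ => Finset.sum_eq_zero fun l _ =>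
        hz i l fun h => hst (Prod.ext_iff.1 h).1, zero_div]
  refine ⟨A, B, ?_, ?_⟩
  · ext z t
    simp only [ContinuousLinearMap.comp_apply, hA, map_sum, map_smul, WithLp.ofLp_sum,
      Finset.sum_apply, PiLp.smul_apply, hBT]
    simp
  · calc ‖A‖ * ‖B‖ ≤ 1 * (2 / ε) := by gcongr
      _ = 2 / ε := one_mul _

end IdentityFactorization

/-! ### Operators factoring through finite-dimensional `ℓ_∞`. -/

section SupFactorization

variable {E F : Type*} [NormedAddCommGroup E] [NormedSpace ℝ E] [NormedAddCommGroup F]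
  [NormedSpace ℝ F]

/-- The operator `U` factors through a finite-dimensional `ℓ_∞` space with constant `C`. -/
def FactorsThroughSup (U : E →L[ℝ] F) (C : ℝ) : Prop :=
  ∃ (ι : Type) (_ : Fintype ι) (A : E →L[ℝ] (ι → ℝ)) (B : (ι → ℝ) →L[ℝ] F),
    U = B ∘L A ∧ ‖A‖ ≤ 1 ∧ ‖B‖ ≤ C

lemma norm_pi_proj_le_one {ι κ : Type*} [Fintype ι] [Fintype κ] (e : κ → ι) :
    ‖(ContinuousLinearMap.pi fun i => ContinuousLinearMap.proj (e i) :
      (ι → ℝ) →L[ℝ] (κ → ℝ))‖ ≤ 1 := by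
  refine ContinuousLinearMap.opNorm_le_bound _ zero_le_one fun x => ?_
  rw [one_mul]
  exact (pi_norm_le_iff_of_nonneg (norm_nonneg x)).2 fun i => norm_le_pi_norm x (e i)

lemma FactorsThroughSup.exists_ellInfty {U : E →L[ℝ] F} {C : ℝ} (h : FactorsThroughSup U C) :
    ∃ (n : ℕ) (A : E →L[ℝ] EllInfty n) (B : EllInfty n →L[ℝ] F),
      U = B ∘L A ∧ ‖A‖ * ‖B‖ ≤ C := by
  obtain ⟨ι, _, A, B, rfl, hA, hB⟩ := h
  let e := Fintype.equivFin ι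
  refine ⟨Fintype.card ι, (ContinuousLinearMap.pi fun i => ContinuousLinearMap.proj (e.symm i)) ∘L A,
    B ∘L ContinuousLinearMap.pi fun i => ContinuousLinearMap.proj (e i), ?_, ?_⟩
  · ext x
    simp only [ContinuousLinearMap.comp_apply]
    congr 1
    ext i
    simp
  · calc _ ≤ (1 * 1) * (C * 1) := by
          refine mul_le_mul ((ContinuousLinearMap.opNorm_comp_le _ _).trans ?_)
            ((ContinuousLinearMap.opNorm_comp_le _ _).trans ?_) (norm_nonneg _) (by norm_num)
          · exact mul_le_mul (norm_pi_proj_le_one _) hA (norm_nonneg _) zero_le_one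
          · exact mul_le_mul hB (norm_pi_proj_le_one _) (norm_nonneg _)
              ((norm_nonneg _).trans hB)
      _ = C := by ring

lemma FactorsThroughSup.add {U V : E →L[ℝ] F} {C D : ℝ} (hU : FactorsThroughSup U C)
    (hV : FactorsThroughSup V D) : FactorsThroughSup (U + V) (C + D) := by
  obtain ⟨ι, _, A, B, rfl, hA, hB⟩ := hU
  obtain ⟨κ, _, A', B', rfl, hA', hB'⟩ := hV
  refine ⟨ι ⊕ κ, inferInstance,
    ContinuousLinearMap.pi (Sum.elim (fun i => ContinuousLinearMap.proj i ∘L A)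
      fun i => ContinuousLinearMap.proj i ∘L A'),
    (B ∘L ContinuousLinearMap.pi fun i => ContinuousLinearMap.proj (Sum.inl i))
      + B' ∘L ContinuousLinearMap.pi fun i => ContinuousLinearMap.proj (Sum.inr i), ?_, ?_, ?_⟩
  · ext x
    simp only [add_apply, ContinuousLinearMap.comp_apply]
    congr 1
  · refine ContinuousLinearMap.opNorm_le_bound _ zero_le_one fun x => ?_
    refine (pi_norm_le_iff_of_nonneg (by positivity)).2 fun i => ?_
    rcases i with i | i
    · exact (norm_le_pi_norm (A x) i).trans (A.le_of_opNorm_le hA x)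
    · exact (norm_le_pi_norm (A' x) i).trans (A'.le_of_opNorm_le hA' x)
  · have hcomp : ∀ {κ : Type} [Fintype κ] {B : (κ → ℝ) →L[ℝ] F} {C : ℝ}, ‖B‖ ≤ C →
        ∀ {η : Type} [Fintype η] (e : κ → η),
          ‖B ∘L (ContinuousLinearMap.pi fun i => ContinuousLinearMap.proj (e i) :
            (η → ℝ) →L[ℝ] (κ → ℝ))‖ ≤ C := fun {κ} _ {B} {C} hB {η} _ e => by
      refine (ContinuousLinearMap.opNorm_comp_le _ _).trans ?_
      rw [← mul_one C]
      exact mul_le_mul hB (norm_pi_proj_le_one e) (norm_nonneg _) ((norm_nonneg _).trans hB)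
    exact (norm_add_le _ _).trans (add_le_add (hcomp hB _) (hcomp hB' _))

end SupFactorization

/-! ### Selecting few columns in each row. -/

/-- Either some choice of `k + 1` disjoint paths has large sums, or the entries outside of a set
with at most `k` elements in each row are small. -/
lemma exists_small_off_rows {m k : ℕ} (a : Fin m → Fin m → ℝ) (ha : ∀ i j, 0 ≤ a i j) {ε : ℝ}
    (hε : 0 < ε)
    (h : ∀ j : Fin (k + 1) → Fin m → Fin m, (∀ i, Function.Injective fun s => j s i) →
      ∃ s, ∑ i, a i (j s i) < ε) :
    ∃ (R : Fin m → Finset (Fin m)) (β : Fin m → ℝ), (∀ i, (R i).card ≤ k) ∧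
      (∀ i, 0 ≤ β i) ∧ ∑ i, β i < ε ∧ ∀ i, ∀ j ∉ R i, a i j ≤ β i := by
  rcases le_or_gt m k with hmk | hkm
  · exact ⟨fun _ => Finset.univ, fun _ => 0, fun i => by simpa using hmk, fun _ => le_rfl,
      by simpa using hε, fun i j hj => absurd (Finset.mem_univ j) hj⟩
  -- Each row is sorted in decreasing order. The ranks `0, …, k` give `k + 1` disjoint paths, and
  -- the path of rank `k` lies below all of them, in particular below the one with small sum.
  let τ : Fin m → Equiv.Perm (Fin m) := fun i => Tuple.sort fun j => -a i j
  have hτ : ∀ i {s t : Fin m}, s ≤ t → a i (τ i t) ≤ a i (τ i s) := fun i s t hst =>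
    neg_le_neg_iff.1 (Tuple.monotone_sort (fun j => -a i j) hst)
  let c : Fin (k + 1) → Fin m := Fin.castLE hkm
  obtain ⟨s, hs⟩ := h (fun s i => τ i (c s)) fun i s t hst =>
    Fin.castLE_injective hkm ((τ i).injective hst)
  refine ⟨fun i => (Finset.univ.filter fun l : Fin m => (l : ℕ) < k).map (τ i).toEmbedding,
    fun i => a i (τ i ⟨k, hkm⟩), fun i => ?_, fun i => ha _ _, ?_, fun i j hj => ?_⟩
  · rw [Finset.card_map]
    calc _ = ((Finset.univ.filter fun l : Fin m => (l : ℕ) < k).map Fin.valEmbedding).card :=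
          (Finset.card_map _).symm
      _ ≤ (Finset.range k).card := Finset.card_le_card fun x hx => by
          obtain ⟨l, hl, rfl⟩ := Finset.mem_map.1 hx
          exact Finset.mem_range.2 (Finset.mem_filter.1 hl).2
      _ = k := Finset.card_range k
  · refine (Finset.sum_le_sum fun i _ => hτ i ?_).trans_lt hs
    exact Fin.le_def.2 (Nat.lt_succ_iff.1 s.2)
  · have hle : (⟨k, hkm⟩ : Fin m) ≤ (τ i).symm j := by
      by_contra hlt
      refine hj (Finset.mem_map.2 ⟨(τ i).symm j, ?_, by simp⟩)
      exact Finset.mem_filter.2 ⟨Finset.mem_univ _, Fin.lt_def.1 (not_le.1 hlt)⟩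
    simpa using hτ i hle

/-! ### Approximation by operators factoring through `ℓ_∞`. -/

section Approximation

variable {m : ℕ} {T : EllInftyEllOne m →L[ℝ] LOne}

/-- Restriction to at most `k` entries in each row factors through `ℓ_∞`. -/
lemma factorsThroughSup_restrict {F : Type*} [NormedAddCommGroup F] [NormedSpace ℝ F]
    (T : EllInftyEllOne m →L[ℝ] F) (hT : ‖T‖ ≤ 1) {R : Fin m → Finset (Fin m)} {k : ℕ}
    (hR : ∀ i, (R i).card ≤ k) :
    ∃ S : EllInftyEllOne m →L[ℝ] F, FactorsThroughSup S k ∧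
      ∀ x, S x = ∑ i, ∑ j, x i j • if j ∈ R i then T (unitVec i j) else 0 := by
  let L : EllInftyEllOne m →ₗ[ℝ] (Fin m × Fin m → ℝ) :=
    { toFun := fun x p => x p.1 p.2
      map_add' := fun x y => rfl
      map_smul' := fun c x => rfl }
  let L' : (Fin m × Fin m → ℝ) →ₗ[ℝ] EllInftyEllOne m :=
    { toFun := fun g i => WithLp.toLp 1 fun j => if j ∈ R i then g (i, j) else 0
      map_add' := fun g h => by
        ext i j
        by_cases hj : j ∈ R i <;> simp [hj]
      map_smul' := fun c g => by
        ext i j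
        by_cases hj : j ∈ R i <;> simp [hj] }
  let A := L.mkContinuous 1 fun x => by
    rw [one_mul]
    refine (pi_norm_le_iff_of_nonneg (norm_nonneg x)).2 fun p => ?_
    exact (Finset.single_le_sum (f := fun j => |x p.1 j|) (fun _ _ => abs_nonneg _)
      (Finset.mem_univ p.2)).trans (sum_abs_le_norm x p.1)
  -- Returning from the maximum norm to the row norm costs at most the number of kept entries in a
  -- row.
  let A' := L'.mkContinuous k fun g => by
    refine (pi_norm_le_iff_of_nonneg (by positivity)).2 fun i => ?_
    rw [norm_ellOne]
    calc ∑ j, |if j ∈ R i then g (i, j) else 0| = ∑ j ∈ R i, |g (i, j)| := by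
          simp [apply_ite abs, Finset.sum_ite_mem]
      _ ≤ ∑ _j ∈ R i, ‖g‖ := Finset.sum_le_sum fun j _ => norm_le_pi_norm g (i, j)
      _ = (R i).card * ‖g‖ := by simp
      _ ≤ k * ‖g‖ := by gcongr; exact hR i
  refine ⟨(T ∘L A') ∘L A, ⟨Fin m × Fin m, inferInstance, A, T ∘L A', rfl,
    L.mkContinuous_norm_le zero_le_one _, ?_⟩, fun x => ?_⟩
  · calc ‖T ∘L A'‖ ≤ ‖T‖ * ‖A'‖ := ContinuousLinearMap.opNorm_comp_le _ _
      _ ≤ 1 * k := mul_le_mul hT (L'.mkContinuous_norm_le (Nat.cast_nonneg k) _) (norm_nonneg _)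
          zero_le_one
      _ = k := one_mul _
  · change T (L' (L x)) = _
    rw [map_array]
    refine Finset.sum_congr rfl fun i _ => Finset.sum_congr rfl fun j _ => ?_
    have hj : (L' (L x)) i j = if j ∈ R i then x i j else 0 := rfl
    rw [hj]
    split_ifs <;> simp

/-- The truncated entry of a random matrix as an element of `L₁`. -/
noncomputable def truncEntry (T : EllInftyEllOne m →L[ℝ] LOne) {K : ℝ} (hK : 0 ≤ K)
    (p : Fin m × Fin m) : LOne :=
  (memLp_trunc (X := fun p : Fin m × Fin m => matrixEntry T p.1 p.2)
    (fun _ => measurable_matrixEntry T _ _) hK p 1).toLp _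

lemma coeFn_truncEntry {K : ℝ} (hK : 0 ≤ K) (p : Fin m × Fin m) :
    truncEntry T hK p =ᵐ[volume] fun ω => trunc K (matrixEntry T p.1 p.2 ω) :=
  MemLp.coeFn_toLp _

lemma norm_sub_truncEntry {K : ℝ} (hK : 0 ≤ K) (i j : Fin m) :
    ‖T (unitVec i j) - truncEntry T hK (i, j)‖ = ∫ ω, excess K (matrixEntry T i j ω) := by
  rw [L1.norm_eq_integral_norm]
  refine integral_congr_ae ?_
  filter_upwards [Lp.coeFn_sub (T (unitVec i j)) (truncEntry T hK (i, j)),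
    coeFn_truncEntry (T := T) hK (i, j)] with ω h1 h2
  rw [h1, Pi.sub_apply, h2, Real.norm_eq_abs, ← abs_sub_trunc]
  rfl

lemma sum_variance_path_le
    (hI : iIndepFun (fun p : Fin m × Fin m => matrixEntry T p.1 p.2) volume)
    (hS : ∀ i j, IsSymmetricRV (matrixEntry T i j) volume) (hT : ‖T‖ ≤ 1) {K : ℝ} (hK : 0 ≤ K)
    (j : Fin m → Fin m) :
    ∑ i, ∫ ω, trunc K (matrixEntry T i (j i) ω) ^ 2 ≤ K ^ 2 + 6 := by
  have h := sum_integral_trunc_sq_le (fun i => measurable_matrixEntry T i (j i))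
    (fun i => integrable_matrixEntry T i (j i)) (iIndepFun_path hI j) hK
    (integral_sqrt_path_le hI hS hT j)
  rw [Real.sq_sqrt (by norm_num)] at h
  linarith

lemma norm_sum_truncEntry_le
    (hI : iIndepFun (fun p : Fin m × Fin m => matrixEntry T p.1 p.2) volume)
    (hS : ∀ i j, IsSymmetricRV (matrixEntry T i j) volume) (hT : ‖T‖ ≤ 1) {K : ℝ} (hK : 0 ≤ K)
    (c : Fin m × Fin m → ℝ) {M : ℝ} (hM : 0 ≤ M) (hc : ∀ i, ∑ j, c (i, j) ^ 2 ≤ M ^ 2) :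
    ‖∑ p, c p • truncEntry T hK p‖ ≤ √(K ^ 2 + 6) * M := by
  have hae : ∀ᵐ ω, ∀ p, truncEntry T hK p ω = trunc K (matrixEntry T p.1 p.2 ω) :=
    ae_all_iff.2 fun p => coeFn_truncEntry hK p
  have heq : ‖∑ p, c p • truncEntry T hK p‖
      = ∫ ω, |∑ p, c p * trunc K (matrixEntry T p.1 p.2 ω)| := by
    rw [norm_sum_smul_LOne]
    refine integral_congr_ae ?_
    filter_upwards [hae] with ω hω
    simp only [hω]
  -- The entries of largest truncated variance, one in each row, form a path, so the path bound
  -- controls the whole matrix.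
  have hrow : ∀ i : Fin m, ∃ l : Fin m, ∀ j, ∫ ω, trunc K (matrixEntry T i j ω) ^ 2
      ≤ ∫ ω, trunc K (matrixEntry T i l ω) ^ 2 := fun i => by
    have : Nonempty (Fin m) := ⟨i⟩
    exact Finite.exists_max fun j => ∫ ω, trunc K (matrixEntry T i j ω) ^ 2
  choose l hl using hrow
  refine abs_le_of_sq_le_sq' ?_ (by positivity) |>.2
  rw [heq, mul_pow, Real.sq_sqrt (by positivity)]
  calc _ ≤ ∑ p : Fin m × Fin m, c p ^ 2 * ∫ ω, trunc K (matrixEntry T p.1 p.2 ω) ^ 2 :=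
        sq_integral_abs_sum_trunc_le (X := fun p : Fin m × Fin m => matrixEntry T p.1 p.2)
          (fun _ => measurable_matrixEntry T _ _) hI (fun _ => hS _ _) hK c
    _ ≤ ∑ i, ∑ j, c (i, j) ^ 2 * ∫ ω, trunc K (matrixEntry T i (l i) ω) ^ 2 := by
        rw [Fintype.sum_prod_type]
        exact Finset.sum_le_sum fun i _ => Finset.sum_le_sum fun j _ =>
          mul_le_mul_of_nonneg_left (hl i j) (sq_nonneg _)
    _ ≤ ∑ i, M ^ 2 * ∫ ω, trunc K (matrixEntry T i (l i) ω) ^ 2 := by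
        refine Finset.sum_le_sum fun i _ => ?_
        rw [← Finset.sum_mul]
        exact mul_le_mul_of_nonneg_right (hc i) (integral_nonneg fun _ => sq_nonneg _)
    _ ≤ (K ^ 2 + 6) * M ^ 2 := by
        rw [← Finset.mul_sum, mul_comm]
        exact mul_le_mul_of_nonneg_right (sum_variance_path_le hI hS hT hK l) (sq_nonneg _)

/-- The operator given by truncated entries factors through `ℓ_∞`. -/
lemma factorsThroughSup_trunc
    (hI : iIndepFun (fun p : Fin m × Fin m => matrixEntry T p.1 p.2) volume)
    (hS : ∀ i j, IsSymmetricRV (matrixEntry T i j) volume) (hT : ‖T‖ ≤ 1) {K : ℝ} (hK : 0 ≤ K)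
    (R : Fin m → Finset (Fin m)) :
    ∃ S : EllInftyEllOne m →L[ℝ] LOne, FactorsThroughSup S √(K ^ 2 + 6) ∧
      ∀ x, S x = ∑ i, ∑ j, x i j • if j ∈ R i then 0 else truncEntry T hK (i, j) := by
  set N : ℝ := (Fintype.card (Fin m → ℤˣ) : ℝ) with hN
  have hN0 : 0 < N := by rw [hN]; exact_mod_cast Fintype.card_pos
  let L : EllInftyEllOne m →ₗ[ℝ] (Fin m × (Fin m → ℤˣ) → ℝ) :=
    { toFun := fun x q => ∑ j, x q.1 j * unitSign (q.2 j)
      map_add' := fun x y => by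
        ext q; simp [add_mul, Finset.sum_add_distrib]
      map_smul' := fun c x => by
        ext q; simp [Finset.mul_sum, mul_assoc] }
  -- These are the Rademacher coefficients of the function `g (i, ·)` on the sign cube. On the range
  -- of `L` they return the array, and Bessel's inequality bounds them for all `g`.
  let c : (Fin m × (Fin m → ℤˣ) → ℝ) → Fin m × Fin m → ℝ := fun g p =>
    if p.2 ∈ R p.1 then 0 else (∑ θ, g (p.1, θ) * unitSign (θ p.2)) / N
  let L' : (Fin m × (Fin m → ℤˣ) → ℝ) →ₗ[ℝ] LOne :=
    { toFun := fun g => ∑ p, c g p • truncEntry T hK p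
      map_add' := fun g h => by
        rw [← Finset.sum_add_distrib]
        refine Finset.sum_congr rfl fun p _ => ?_
        rw [← add_smul]
        congr 1
        simp only [c]
        split_ifs
        · simp
        · simp only [Pi.add_apply, add_mul, Finset.sum_add_distrib, add_div]
      map_smul' := fun a g => by
        rw [RingHom.id_apply, Finset.smul_sum]
        refine Finset.sum_congr rfl fun p _ => ?_
        rw [smul_smul]
        congr 1
        simp only [c]
        split_ifs
        · simp
        · simp only [Pi.smul_apply, smul_eq_mul, mul_assoc, ← Finset.mul_sum, mul_div_assoc] }
  let A := L.mkContinuous 1 fun x => by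
    rw [one_mul]
    refine (pi_norm_le_iff_of_nonneg (norm_nonneg x)).2 fun q => ?_
    change |∑ j, x q.1 j * unitSign (q.2 j)| ≤ _
    refine (Finset.abs_sum_le_sum_abs _ _).trans ?_
    simp only [abs_mul, abs_unitSign, mul_one]
    exact sum_abs_le_norm x q.1
  have hB : ∀ g, ‖L' g‖ ≤ √(K ^ 2 + 6) * ‖g‖ := fun g => by
    refine norm_sum_truncEntry_le hI hS hT hK (c g) (norm_nonneg g) fun i => ?_
    refine le_trans (Finset.sum_le_sum fun j _ => ?_)
      (bessel_rademacher (fun θ => g (i, θ)) fun θ => norm_le_pi_norm g (i, θ))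
    simp only [c]
    split_ifs
    · rw [zero_pow two_ne_zero]; exact sq_nonneg _
    · exact le_rfl
  refine ⟨L'.mkContinuous _ hB ∘L A, ⟨_, inferInstance, A, L'.mkContinuous _ hB, rfl,
    L.mkContinuous_norm_le zero_le_one _, L'.mkContinuous_norm_le (Real.sqrt_nonneg _) _⟩,
    fun x => ?_⟩
  change ∑ p, c (L x) p • truncEntry T hK p = _
  rw [Fintype.sum_prod_type]
  refine Finset.sum_congr rfl fun i _ => Finset.sum_congr rfl fun j _ => ?_
  have hcoef : (∑ θ : Fin m → ℤˣ, L x (i, θ) * unitSign (θ j)) / N = x i j := by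
    have h1 : ∑ θ : Fin m → ℤˣ, L x (i, θ) * unitSign (θ j)
        = ∑ l, x i l * ∑ θ : Fin m → ℤˣ, unitSign (θ l) * unitSign (θ j) := by
      simp only [L, LinearMap.coe_mk, AddHom.coe_mk, Finset.sum_mul, Finset.mul_sum]
      rw [Finset.sum_comm]
      simp only [mul_assoc]
    simp only [h1, sum_unitSign_mul, ← hN]
    simp [hN0.ne']
  simp only [c]
  split_ifs
  · simp
  · rw [hcoef]

/-- The entries split into the selected ones, the truncations of the others, and the tails of the
others. The tails in row `i` have norm at most `β i`, so they contribute less than `ε` altogether.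
-/
lemma exists_approx_factorsThroughSup
    (hI : iIndepFun (fun p : Fin m × Fin m => matrixEntry T p.1 p.2) volume)
    (hS : ∀ i j, IsSymmetricRV (matrixEntry T i j) volume) (hT : ‖T‖ ≤ 1) {K : ℝ} (hK : 0 ≤ K)
    {k : ℕ} {ε : ℝ} (hε : 0 < ε)
    (h : ∀ j : Fin (k + 1) → Fin m → Fin m, (∀ i, Function.Injective fun s => j s i) →
      ∃ s, ∑ i, ∫ ω, excess K (matrixEntry T i (j s i) ω) < ε) :
    ∃ S : EllInftyEllOne m →L[ℝ] LOne, FactorsThroughSup S (k + √(K ^ 2 + 6)) ∧ ‖T - S‖ < ε := by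
  obtain ⟨R, β, hR, hβ0, hβ, hRβ⟩ := exists_small_off_rows
    (fun i j => ∫ ω, excess K (matrixEntry T i j ω))
    (fun i j => integral_nonneg fun _ => excess_nonneg _ _) hε h
  obtain ⟨S₁, hS₁, hS₁x⟩ := factorsThroughSup_restrict T hT hR
  obtain ⟨S₂, hS₂, hS₂x⟩ := factorsThroughSup_trunc hI hS hT hK R
  refine ⟨S₁ + S₂, hS₁.add hS₂, lt_of_le_of_lt ?_ hβ⟩
  refine ContinuousLinearMap.opNorm_le_bound _ (Finset.sum_nonneg fun i _ => hβ0 i) fun x => ?_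
  have hx : (T - (S₁ + S₂)) x = ∑ i, ∑ j, x i j •
      if j ∈ R i then 0 else T (unitVec i j) - truncEntry T hK (i, j) := by
    rw [sub_apply, add_apply, hS₁x, hS₂x, map_array T x]
    simp only [← Finset.sum_add_distrib, ← Finset.sum_sub_distrib, ← smul_add, ← smul_sub]
    refine Finset.sum_congr rfl fun i _ => Finset.sum_congr rfl fun j _ => ?_
    split_ifs <;> simp
  rw [hx, Finset.sum_mul]
  refine (norm_sum_le _ _).trans (Finset.sum_le_sum fun i _ => ?_)
  calc _ ≤ ∑ j, |x i j| * β i := by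
        refine (norm_sum_le _ _).trans (Finset.sum_le_sum fun j _ => ?_)
        rw [norm_smul, Real.norm_eq_abs]
        refine mul_le_mul_of_nonneg_left ?_ (abs_nonneg _)
        split_ifs with hj
        · simpa using hβ0 i
        · rw [norm_sub_truncEntry]; exact hRβ i j hj
    _ ≤ β i * ‖x‖ := by
        rw [← Finset.sum_mul, mul_comm]
        exact mul_le_mul_of_nonneg_left (sum_abs_le_norm x i) (hβ0 i)

end Approximation

/-! ### The dichotomy. -/

theorem theoremC
    (T : ∀ m : ℕ, EllInftyEllOne m →L[ℝ] LOne)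
    (hindep : ∀ m : ℕ,
      iIndepFun (fun p : Fin m × Fin m => matrixEntry (T m) p.1 p.2) volume)
    (hsymm : ∀ (m : ℕ) (i j : Fin m), IsSymmetricRV (matrixEntry (T m) i j) volume)
    (hnorm : ∀ m : ℕ, ‖T m‖ ≤ 1) :
    (∀ m : ℕ, IsGreatest
      (Set.range fun j : Fin m → Fin m => ∫ ω, |∑ i, matrixEntry (T m) i (j i) ω|) ‖T m‖) ∧
    Xor
      (UniformlyFactorThrough (fun k : ℕ => ContinuousLinearMap.id ℝ (EllOne k)) T)
      (UniformlyApproxFactorThrough T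
        (fun k : ℕ => ContinuousLinearMap.id ℝ (EllInfty k))) := by
  refine ⟨fun m => isGreatest_norm (hindep m) (hsymm m), ?_⟩
  by_cases hdich : ∃ ε : ℝ, 0 < ε ∧ ∀ k : ℕ, ∃ (m : ℕ) (j : Fin k → Fin m → Fin m),
      (∀ i, Function.Injective fun s => j s i) ∧
      ∀ s, ε ≤ ∑ i, ∫ ω, excess (4 * k) (matrixEntry (T m) i (j s i) ω)
  · have hfac : UniformlyFactorThrough (fun k : ℕ => ContinuousLinearMap.id ℝ (EllOne k)) T := by
      obtain ⟨ε, hε, h⟩ := hdich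
      refine ⟨2 / ε, by positivity, fun k => ?_⟩
      obtain ⟨m, j, hj, hex⟩ := h k
      exact ⟨m, exists_factorization_id (hindep m) (hsymm m) (hnorm m) hε j hj hex⟩
    exact Or.inl ⟨hfac, not_uniformlyApproxFactorThrough T hfac⟩
  · have happ : UniformlyApproxFactorThrough T
        (fun k : ℕ => ContinuousLinearMap.id ℝ (EllInfty k)) := by
      intro ε hε
      push Not at hdich
      obtain ⟨k, hk⟩ := hdich ε hε
      cases k with
      -- A family of no paths satisfies the condition vacuously, so the failing number of paths is
      -- positive and can be written `k + 1`.
      | zero =>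
        obtain ⟨s, -⟩ := hk 0 (fun s => s.elim0) fun i => i.elim0
        exact s.elim0
      | succ k =>
        refine ⟨k + √((4 * ((k + 1 : ℕ) : ℝ)) ^ 2 + 6), by positivity, fun m => ?_⟩
        obtain ⟨S, hS, hTS⟩ := exists_approx_factorsThroughSup (hindep m) (hsymm m) (hnorm m)
          (K := 4 * ((k + 1 : ℕ) : ℝ)) (by positivity) hε (hk m)
        obtain ⟨n, A, B, rfl, hAB⟩ := hS.exists_ellInfty
        exact ⟨n, A, B, hTS, hAB⟩
    exact Or.inr ⟨happ, fun hfac => not_uniformlyApproxFactorThrough T hfac happ⟩
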